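/- Write $\mathbb R_+=[0,\infty)$. For $v_1,v_2,v_3\in\mathbb R^2$ let $\tilde c(v_1,v_2,v_3)=\sum_{1\le i<j\le 3}\frac1{|v_i-v_j|}\in(0,+\infty]$, and for $r_1,r_2,r_3\in\mathbb R_+$ let $$c(r_1,r_2,r_3)=\min\{\tilde c(v_1,v_2,v_3)\;:\;|v_i|=r_i,\ i=1,2,3\}$$ be the radial Coulomb cost. For a Borel probability measure $\rho$ on $\mathbb R_+$ let $\Pi_3(\rho)$ be the set of Borel probability measures on $(\mathbb R_+)^3$ all three of whose marginals are $\rho$. The radial problem is to minimize $\int c\,d\gamma$ over $\gamma\in\Pi_3(\rho)$. Let $\rho$ be atomless and positive everywhere, that is, $\rho(U)>0$ for every nonempty open interval $U\subset\mathbb R_+$. Let $0<s_1<s_2$ be the numbers with $\rho([0,s_1))=\rho([s_1,s_2))=\rho([s_2,\infty))=\frac13$, and let $F(r)=\rho([0,r))$. For a word $abc\in\{D,I\}^3$ let $S_{abc}$ be the $\rho$-preserving map ($\rho$-a.e. unique) that sends $[0,s_1)$ to $[s_1,s_2)$, $[s_1,s_2)$ to $[s_2,\infty)$ and $[s_2,\infty)$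 to $[0,s_1)$, up to endpoints, with the monotonicities $a$, $b$, $c$ respectively ($D$ decreasing, $I$ increasing). Explicitly, - on $[0,s_1)$ it is $F^{-1}(F(x)+\frac13)$ if $a=I$ and $F^{-1}(\frac23-F(x))$ if $a=D$; - on $[s_1,s_2)$ it is $F^{-1}(F(x)+\frac13)$ if $b=I$ and $F^{-1}(\frac43-F(x))$ if $b=D$; - on $[s_2,\infty)$ it is $F^{-1}(F(x)-\frac23)$ if $c=I$ and $F^{-1}(1-F(x))$ if $c=D$. Let $T=S_{DDI}$ be the DDI (Seidl) map. **Theorem.** Suppose that $\frac{s_1}{s_2}>\frac{1+2\sqrt3}{5}$ and that $$T(x)\,(T^2(x)-x)^3-x\,(T^2(x)+T(x))^3-T^2(x)\,(x+T(x))^3\ \ge\ 0\qquad\text{for }\rho\text{-a.e. }x\in(0,s_1).$$ Then for every $S=S_{abc}$ with $abc\in\{D,I\}^3$ (in particular for $III$, $DDI$, $DID$, $IDD$, the words for which $S^3=\mathrm{Id}$ $\rho$-a.e.) the plan $(\mathrm{Id},S,S^2)_\#\rho$ belongs to $\Pi_3(\rho)$ but does not minimize $\int c\,d\gamma$ over $\Pi_3(\rho)$.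 Moreover, smooth examples exist: there is a function $f$ on $[0,\infty)$, infinitely differentiable (one-sidedly at $0$) and strictly positive everywhere, such that $\rho=f(x)\,dx$ is a probability measure on $\mathbb R_+$ that satisfies all these hypotheses, and hence the conclusion. -/

import Mathlib

open MeasureTheory Set
open scoped ENNReal ContDiff

noncomputable section

namespace RadialCoulomb

/-- The plane `ℝ²` with its Euclidean norm. -/
abbrev Plane : Type := EuclideanSpace ℝ (Fin 2)

/-- The three-particle Coulomb cost, with values in `[0, ∞]`; it is `∞` as soon as two of the
particles coincide, because `0⁻¹ = ∞` in `ℝ≥0∞`. -/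
def coulombCost (v₁ v₂ v₃ : Plane) : ℝ≥0∞ :=
  (edist v₁ v₂)⁻¹ + (edist v₁ v₃)⁻¹ + (edist v₂ v₃)⁻¹

/-- The radial cost: the least Coulomb cost of three points of the plane at distances
`r₁`, `r₂`, `r₃` from the origin. -/
def radialCost (r₁ r₂ r₃ : ℝ) : ℝ≥0∞ :=
  ⨅ (v₁ : Plane) (v₂ : Plane) (v₃ : Plane)
    (_ : ‖v₁‖ = r₁) (_ : ‖v₂‖ = r₂) (_ : ‖v₃‖ = r₃), coulombCost v₁ v₂ v₃

/-- The couplings of three copies of `ρ`. -/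
def couplings (ρ : Measure ℝ) : Set (Measure (ℝ × ℝ × ℝ)) :=
  {γ | γ.map (fun p => p.1) = ρ ∧ γ.map (fun p => p.2.1) = ρ ∧ γ.map (fun p => p.2.2) = ρ}

/-- The total radial cost of a plan. -/
def planCost (γ : Measure (ℝ × ℝ × ℝ)) : ℝ≥0∞ :=
  ∫⁻ p, radialCost p.1 p.2.1 p.2.2 ∂γ

/-- `γ` solves the radial problem: it minimizes the total radial cost among the couplings. -/
def IsOptimalPlan (ρ : Measure ℝ) (γ : Measure (ℝ × ℝ × ℝ)) : Prop :=
  γ ∈ couplings ρ ∧ ∀ γ' ∈ couplings ρ, planCost γ ≤ planCost γ'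

/-- The plan `(Id, S, S²)_# ρ`. -/
def mongePlan (ρ : Measure ℝ) (S : ℝ → ℝ) : Measure (ℝ × ℝ × ℝ) :=
  ρ.map (fun x => (x, S x, S (S x)))

/-- The distribution function `F r = ρ [0, r)`. -/
def distFun (ρ : Measure ℝ) (r : ℝ) : ℝ := ρ.real (Ico 0 r)

/-- The inverse of the distribution function. Where `F` is a continuous strictly increasing
bijection from `[0, ∞)` to `[0, 1)` this is the inverse function on `[0, 1)`. -/
def distInv (ρ : Measure ℝ) (t : ℝ) : ℝ := sInf {r : ℝ | 0 ≤ r ∧ t ≤ distFun ρ r}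

/-- The two letters `I` (increasing) and `D` (decreasing). -/
inductive Letter : Type
  | I
  | D

/-- The `ρ`-preserving map with the monotonicities `a` from `[0, s₁)` to `[s₁, s₂)`, `b` from
`[s₁, s₂)` to `[s₂, ∞)`, and `c` from `[s₂, ∞)` to `[0, s₁)`. -/
def letterMap (ρ : Measure ℝ) (s₁ s₂ : ℝ) (a b c : Letter) (x : ℝ) : ℝ :=
  if x < s₁ then
    match a with
    | Letter.I => distInv ρ (1 / 3 + distFun ρ x)
    | Letter.D => distInv ρ (2 / 3 - distFun ρ x)
  else if x < s₂ then
    match b with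
    | Letter.I => distInv ρ (1 / 3 + distFun ρ x)
    | Letter.D => distInv ρ (4 / 3 - distFun ρ x)
  else
    match c with
    | Letter.I => distInv ρ (distFun ρ x - 2 / 3)
    | Letter.D => distInv ρ (1 - distFun ρ x)

/-- The DDI map, also called the Seidl map. -/
def ddiMap (ρ : Measure ℝ) (s₁ s₂ : ℝ) : ℝ → ℝ :=
  letterMap ρ s₁ s₂ Letter.D Letter.D Letter.I

/-- The class `{D, I}³`. It contains `III`, `DDI`, `DID`, `IDD`, the four maps whose third iterate
is the identity, and also the four remaining words. -/
def letterClass (ρ : Measure ℝ) (s₁ s₂ : ℝ) : Set (ℝ → ℝ) :=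
  {S | ∃ a b c : Letter, S = letterMap ρ s₁ s₂ a b c}

/-- `ρ` is an atomless probability measure on `[0, ∞)` that is positive everywhere (it charges every
nonempty open subinterval of `[0, ∞)`), and `s₁`, `s₂` cut `[0, ∞)` into three parts of equal
mass. -/
structure IsPositiveRadial (ρ : Measure ℝ) (s₁ s₂ : ℝ) : Prop where
  prob : IsProbabilityMeasure ρ
  noAtoms : ∀ x : ℝ, ρ {x} = 0
  halfLine : ρ (Iio 0) = 0
  pos : ∀ a b : ℝ, 0 ≤ a → a < b → 0 < ρ (Ioo a b)
  mass₁ : ρ (Ico 0 s₁) = 1 / 3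
  mass₂ : ρ (Ico s₁ s₂) = 1 / 3
  mass₃ : ρ (Ici s₂) = 1 / 3

/-- The left-hand side of the polynomial condition. -/
def poly (r₁ r₂ r₃ : ℝ) : ℝ :=
  r₂ * (r₃ - r₁) ^ 3 - r₁ * (r₃ + r₂) ^ 3 - r₃ * (r₁ + r₂) ^ 3

/-- The polynomial condition along the graph `(x, T x, T² x)` of the DDI map `T`. -/
def PolyOnDDI (ρ : Measure ℝ) (s₁ s₂ : ℝ) : Prop :=
  ∀ᵐ x ∂ρ, x ∈ Ioo 0 s₁ →
    0 ≤ poly x (ddiMap ρ s₁ s₂ x) (ddiMap ρ s₁ s₂ (ddiMap ρ s₁ s₂ x))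

/-- For every map `S` in the class `{D, I}³`, the plan `(Id, S, S²)_# ρ` is a coupling of three
copies of `ρ`, but not an optimal one. -/
def NoOptimalInClass (ρ : Measure ℝ) (s₁ s₂ : ℝ) : Prop :=
  ∀ S ∈ letterClass ρ s₁ s₂,
    mongePlan ρ S ∈ couplings ρ ∧ ¬ IsOptimalPlan ρ (mongePlan ρ S)

/-- The measure on `[0, ∞)` with Lebesgue density `f`. -/
def densityMeasure (f : ℝ → ℝ) : Measure ℝ :=
  (volume.restrict (Ici 0)).withDensity (fun x => ENNReal.ofReal (f x))

end RadialCoulomb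

end

/-!
The plan of a word `abc` contains the branch of the points `(x, S x, S² x)` with `x` in the first
third, and the letters `a` and `b` alone decide the monotonicities on that branch. A plan of finite
cost is not optimal as soon as two points of its support can exchange some of their coordinates and
become cheaper together (`not_isOptimalPlan_of_swap`). So each of the four pairs `ab` needs one good
swap on this branch.

For `x < z`, placing the three particles on a line, the second one opposite to the other two, costs
`1 / (x + y) + 1 / (z - x) + 1 / (y + z)`, and this is the radial cost wherever `poly x y z ≥ 0`
(`collinearCost_le_radialCost`). As `x → 0` the polynomial tends to `y z (z² - y²)`, so on the
branches of the words `II_`, `DI_` and `ID_`, where `y < z` stay apart as `x → 0`, the cost near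
`x = 0` is the collinear one. Each of its three terms is a strictly convex function of a sum
`x + y`, `-x + z` or `y + z`, hence strictly prefers the two summands to vary in opposite
directions. For these three words two terms vary the wrong way, and exchanging one coordinate of two
nearby points repairs both while leaving the third term alone.

On the branch of `DD_`, on which every term of the collinear cost varies the right way, a swap
between the two ends works: `(0, s₂, s₂)` and `(s₁, s₁, ∞)` exchange their first coordinates. The
new point `(s₁, s₂, s₂)` is cheap because its particles can sit at angles of 120 degrees, and the
lower bound on `s₁ / s₂` makes the new total smaller (`not_isOptimalPlan_DD`).

The smooth example is built from its quantile function `G` on `[0, 1)`, in terms of which the points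
of the DDI branch are `G u`, `G (2/3 - u)`, `G (2/3 + u)`. The function `G` is nearly flat up to
`1/6`, climbs from about `0` to `1` between `1/6` and `1/4`, stays almost constant up to `2/3`, and
has a pole at `1` (`poly_quantile_nonneg`). The density is the derivative of the inverse of `G`.
-/

namespace RadialCoulomb

open Filter Topology

/-! ### Bounds for the radial cost -/

/-- The Coulomb cost of three points on a line through the origin, with the second one on the
opposite side of the other two. -/
noncomputable def collinearCost (x y z : ℝ) : ℝ := 1 / (x + y) + 1 / (z - x) + 1 / (y + z)

lemma ofReal_inv_add_inv_add_inv {a b c : ℝ} (ha : 0 < a) (hb : 0 < b) (hc : 0 < c) :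
    (ENNReal.ofReal a)⁻¹ + (ENNReal.ofReal b)⁻¹ + (ENNReal.ofReal c)⁻¹ =
      ENNReal.ofReal (1 / a + 1 / b + 1 / c) := by
  rw [ENNReal.ofReal_add (by positivity) (by positivity),
    ENNReal.ofReal_add (by positivity) (by positivity), one_div, one_div, one_div,
    ENNReal.ofReal_inv_of_pos ha, ENNReal.ofReal_inv_of_pos hb, ENNReal.ofReal_inv_of_pos hc]

lemma radialCost_le_of_vectors (v₁ v₂ v₃ : Plane) (h₁₂ : 0 < dist v₁ v₂) (h₁₃ : 0 < dist v₁ v₃)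
    (h₂₃ : 0 < dist v₂ v₃) :
    radialCost ‖v₁‖ ‖v₂‖ ‖v₃‖ ≤
      ENNReal.ofReal (1 / dist v₁ v₂ + 1 / dist v₁ v₃ + 1 / dist v₂ v₃) := by
  refine (iInf_le_of_le v₁ <| iInf_le_of_le v₂ <| iInf_le_of_le v₃ <| iInf_le_of_le rfl <|
    iInf_le_of_le rfl <| iInf_le_of_le rfl le_rfl).trans_eq ?_
  rw [coulombCost, edist_dist, edist_dist, edist_dist, ofReal_inv_add_inv_add_inv h₁₂ h₁₃ h₂₃]

lemma norm_vec (a b : ℝ) : ‖(!₂[a, b] : Plane)‖ = √(a ^ 2 + b ^ 2) := by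
  simp [EuclideanSpace.norm_eq, Fin.sum_univ_two]

lemma dist_vec (a b a' b' : ℝ) :
    dist (!₂[a, b] : Plane) !₂[a', b'] = √((a - a') ^ 2 + (b - b') ^ 2) := by
  simp [EuclideanSpace.dist_eq, Fin.sum_univ_two, Real.dist_eq]

lemma radialCost_le_collinearCost {x y z : ℝ} (hx : 0 ≤ x) (hy : 0 < y) (hz : x < z) :
    radialCost x y z ≤ ENNReal.ofReal (collinearCost x y z) := by
  have n₁ : ‖(!₂[x, 0] : Plane)‖ = x := by
    rw [norm_vec, show x ^ 2 + 0 ^ 2 = x ^ 2 by ring, Real.sqrt_sq hx]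
  have n₂ : ‖(!₂[-y, 0] : Plane)‖ = y := by
    rw [norm_vec, show (-y) ^ 2 + 0 ^ 2 = y ^ 2 by ring, Real.sqrt_sq hy.le]
  have n₃ : ‖(!₂[z, 0] : Plane)‖ = z := by
    rw [norm_vec, show z ^ 2 + 0 ^ 2 = z ^ 2 by ring, Real.sqrt_sq (by linarith)]
  have d₁₂ : dist (!₂[x, 0] : Plane) !₂[-y, 0] = x + y := by
    rw [dist_vec, show (x - -y) ^ 2 + (0 - 0 : ℝ) ^ 2 = (x + y) ^ 2 by ring,
      Real.sqrt_sq (by linarith)]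
  have d₁₃ : dist (!₂[x, 0] : Plane) !₂[z, 0] = z - x := by
    rw [dist_vec, show (x - z) ^ 2 + (0 - 0 : ℝ) ^ 2 = (z - x) ^ 2 by ring,
      Real.sqrt_sq (by linarith)]
  have d₂₃ : dist (!₂[-y, 0] : Plane) !₂[z, 0] = y + z := by
    rw [dist_vec, show (-y - z) ^ 2 + (0 - 0 : ℝ) ^ 2 = (y + z) ^ 2 by ring,
      Real.sqrt_sq (by linarith)]
  have := radialCost_le_of_vectors !₂[x, 0] !₂[-y, 0] !₂[z, 0] (by rw [d₁₂]; linarith)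
    (by rw [d₁₃]; linarith) (by rw [d₂₃]; linarith)
  rwa [n₁, n₂, n₃, d₁₂, d₁₃, d₂₃] at this

/-- The distance of two points at distances `a` and `b` from the origin that are seen from it at
an angle of 120 degrees. -/
noncomputable def obtuseDist (a b : ℝ) : ℝ := √(a ^ 2 + a * b + b ^ 2)

lemma le_obtuseDist_left {s a b : ℝ} (hs : 0 ≤ s) (ha : s ≤ a) (hb : 0 ≤ b) :
    s ≤ obtuseDist a b := by
  refine Real.le_sqrt_of_sq_le ?_
  nlinarith [mul_nonneg (hs.trans ha) hb, sq_nonneg b]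

lemma obtuseDist_comm (a b : ℝ) : obtuseDist a b = obtuseDist b a := by
  unfold obtuseDist; congr 1; ring

lemma le_obtuseDist_right {s a b : ℝ} (hs : 0 ≤ s) (ha : 0 ≤ a) (hb : s ≤ b) :
    s ≤ obtuseDist a b := by
  rw [obtuseDist_comm]; exact le_obtuseDist_left hs hb ha

lemma sqrt_three_mul_le_obtuseDist {s a b : ℝ} (hs : 0 ≤ s) (ha : s ≤ a) (hb : s ≤ b) :
    √3 * s ≤ obtuseDist a b := by
  refine Real.le_sqrt_of_sq_le ?_
  rw [mul_pow, Real.sq_sqrt (by norm_num)]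
  nlinarith [mul_le_mul ha hb hs (hs.trans ha), mul_le_mul ha ha hs (hs.trans ha),
    mul_le_mul hb hb hs (hs.trans hb)]

lemma radialCost_le_obtuse {x y z : ℝ} (hx : 0 ≤ x) (hy : 0 ≤ y) (hz : 0 ≤ z)
    (hxy : 0 < obtuseDist x y) (hxz : 0 < obtuseDist x z) (hyz : 0 < obtuseDist y z) :
    radialCost x y z ≤
      ENNReal.ofReal (1 / obtuseDist x y + 1 / obtuseDist x z + 1 / obtuseDist y z) := by
  have h3 : √3 ^ 2 = 3 := Real.sq_sqrt (by norm_num)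
  have n₁ : ‖(!₂[x, 0] : Plane)‖ = x := by
    rw [norm_vec, show x ^ 2 + 0 ^ 2 = x ^ 2 by ring, Real.sqrt_sq hx]
  have n₂ : ‖(!₂[-(y / 2), √3 * y / 2] : Plane)‖ = y := by
    rw [norm_vec, show (-(y / 2)) ^ 2 + (√3 * y / 2) ^ 2 = (1 + √3 ^ 2) / 4 * y ^ 2 by ring, h3,
      show (1 + 3 : ℝ) / 4 * y ^ 2 = y ^ 2 by ring, Real.sqrt_sq hy]
  have n₃ : ‖(!₂[-(z / 2), -(√3 * z / 2)] : Plane)‖ = z := by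
    rw [norm_vec, show (-(z / 2)) ^ 2 + (-(√3 * z / 2)) ^ 2 = (1 + √3 ^ 2) / 4 * z ^ 2 by ring, h3,
      show (1 + 3 : ℝ) / 4 * z ^ 2 = z ^ 2 by ring, Real.sqrt_sq hz]
  have d₁₂ : dist (!₂[x, 0] : Plane) !₂[-(y / 2), √3 * y / 2] = obtuseDist x y := by
    rw [dist_vec, obtuseDist]; congr 1; linear_combination (y ^ 2 / 4) * h3
  have d₁₃ : dist (!₂[x, 0] : Plane) !₂[-(z / 2), -(√3 * z / 2)] = obtuseDist x z := by
    rw [dist_vec, obtuseDist]; congr 1; linear_combination (z ^ 2 / 4) * h3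
  have d₂₃ : dist (!₂[-(y / 2), √3 * y / 2] : Plane) !₂[-(z / 2), -(√3 * z / 2)] =
      obtuseDist y z := by
    rw [dist_vec, obtuseDist]; congr 1; linear_combination ((y + z) ^ 2 / 4) * h3
  have := radialCost_le_of_vectors !₂[x, 0] !₂[-(y / 2), √3 * y / 2] !₂[-(z / 2), -(√3 * z / 2)]
    (by rwa [d₁₂]) (by rwa [d₁₃]) (by rwa [d₂₃])
  rwa [n₁, n₂, n₃, d₁₂, d₁₃, d₂₃] at this

lemma radialCost_le_three_div {s x y z : ℝ} (hs : 0 < s) (hx : 0 ≤ x) (hy : 0 ≤ y) (hz : 0 ≤ z)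
    (h : (s ≤ x ∧ s ≤ y) ∨ (s ≤ x ∧ s ≤ z) ∨ (s ≤ y ∧ s ≤ z)) :
    radialCost x y z ≤ ENNReal.ofReal (3 / s) := by
  have key : s ≤ obtuseDist x y ∧ s ≤ obtuseDist x z ∧ s ≤ obtuseDist y z := by
    rcases h with ⟨h, h'⟩ | ⟨h, h'⟩ | ⟨h, h'⟩
    · exact ⟨le_obtuseDist_left hs.le h hy, le_obtuseDist_left hs.le h hz,
        le_obtuseDist_left hs.le h' hz⟩
    · exact ⟨le_obtuseDist_left hs.le h hy, le_obtuseDist_left hs.le h hz,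
        le_obtuseDist_right hs.le hy h'⟩
    · exact ⟨le_obtuseDist_right hs.le hx h, le_obtuseDist_right hs.le hx h',
        le_obtuseDist_left hs.le h hz⟩
  obtain ⟨h₁, h₂, h₃⟩ := key
  refine (radialCost_le_obtuse hx hy hz (hs.trans_le h₁) (hs.trans_le h₂) (hs.trans_le h₃)).trans
    (ENNReal.ofReal_le_ofReal ?_)
  rw [show 3 / s = 1 / s + 1 / s + 1 / s by ring]
  gcongr

lemma le_radialCost {x y z : ℝ} {K : ℝ}
    (h : ∀ v₁ v₂ v₃ : Plane, ‖v₁‖ = x → ‖v₂‖ = y → ‖v₃‖ = z → 0 < dist v₁ v₂ → 0 < dist v₁ v₃ →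
      0 < dist v₂ v₃ → K ≤ 1 / dist v₁ v₂ + 1 / dist v₁ v₃ + 1 / dist v₂ v₃) :
    ENNReal.ofReal K ≤ radialCost x y z := by
  refine le_iInf fun v₁ => le_iInf fun v₂ => le_iInf fun v₃ => le_iInf fun h₁ => le_iInf fun h₂ =>
    le_iInf fun h₃ => ?_
  rw [coulombCost]
  rcases eq_or_ne v₁ v₂ with rfl | h₁₂
  · simp
  rcases eq_or_ne v₁ v₃ with rfl | h₁₃
  · simp
  rcases eq_or_ne v₂ v₃ with rfl | h₂₃
  · simp
  rw [← dist_pos] at h₁₂ h₁₃ h₂₃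
  rw [edist_dist, edist_dist, edist_dist, ofReal_inv_add_inv_add_inv h₁₂ h₁₃ h₂₃]
  exact ENNReal.ofReal_le_ofReal (h v₁ v₂ v₃ h₁ h₂ h₃ h₁₂ h₁₃ h₂₃)

lemma ofReal_sum_le_radialCost (x y z : ℝ) :
    ENNReal.ofReal (1 / (x + y) + 1 / (x + z) + 1 / (y + z)) ≤ radialCost x y z := by
  refine le_radialCost fun v₁ v₂ v₃ h₁ h₂ h₃ h₁₂ h₁₃ h₂₃ => ?_
  subst h₁ h₂ h₃
  gcongr <;> exact dist_le_norm_add_norm _ _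

/-- The tangent line of the convex function `t ↦ 1 / √t` at `D ^ 2`. -/
lemma tangent_le_one_div {d D : ℝ} (hd : 0 < d) (hD : 0 < D) :
    1 / D + (D ^ 2 - d ^ 2) / (2 * D ^ 3) ≤ 1 / d := by
  rw [div_add_div _ _ hD.ne' (by positivity), div_le_div_iff₀ (by positivity) hd]
  have : 0 ≤ D * ((D - d) ^ 2 * (2 * D + d)) := by positivity
  nlinarith [this]

/-- If the polynomial is nonnegative, no configuration is cheaper than the collinear one. By the
tangent-line bound for each reciprocal distance, the excess over the collinear cost is at least a
quadratic form in the lengths `‖e₁ + e₂‖`, `‖e₂ + e₃‖`, `‖e₁ - e₃‖`, where `eᵢ = vᵢ / ‖vᵢ‖`; the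
triangle inequality bounds the last by the sum of the first two, and the polynomial is the
discriminant that makes the form nonnegative. -/
lemma collinearCost_le_radialCost {x y z : ℝ} (hx : 0 < x) (hy : 0 < y) (hz : x < z)
    (hp : 0 ≤ poly x y z) : ENNReal.ofReal (collinearCost x y z) ≤ radialCost x y z := by
  refine le_radialCost fun v₁ v₂ v₃ h₁ h₂ h₃ h₁₂ h₁₃ h₂₃ => ?_
  have hz0 : 0 < z := hx.trans hz
  have hzx : 0 < z - x := sub_pos.2 hz
  set A := ‖x⁻¹ • v₁ + y⁻¹ • v₂‖ with hA
  set S := ‖y⁻¹ • v₂ + z⁻¹ • v₃‖ with hS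
  set B := ‖x⁻¹ • v₁ - z⁻¹ • v₃‖ with hB
  have hBAS : B ≤ A + S := by
    rw [hB, show x⁻¹ • v₁ - z⁻¹ • v₃ = (x⁻¹ • v₁ + y⁻¹ • v₂) - (y⁻¹ • v₂ + z⁻¹ • v₃) by abel]
    exact norm_sub_le _ _
  have hA2 : (x + y) ^ 2 - dist v₁ v₂ ^ 2 = x * y * A ^ 2 := by
    rw [hA, dist_eq_norm, norm_sub_sq_real, norm_add_sq_real, norm_smul, norm_smul,
      real_inner_smul_left, real_inner_smul_right, h₁, h₂, Real.norm_of_nonneg (by positivity),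
      Real.norm_of_nonneg (by positivity)]
    field_simp; ring
  have hS2 : (y + z) ^ 2 - dist v₂ v₃ ^ 2 = y * z * S ^ 2 := by
    rw [hS, dist_eq_norm, norm_sub_sq_real, norm_add_sq_real, norm_smul, norm_smul,
      real_inner_smul_left, real_inner_smul_right, h₂, h₃, Real.norm_of_nonneg (by positivity),
      Real.norm_of_nonneg (by positivity)]
    field_simp; ring
  have hB2 : (z - x) ^ 2 - dist v₁ v₃ ^ 2 = -(x * z * B ^ 2) := by
    rw [hB, dist_eq_norm, norm_sub_sq_real, norm_sub_sq_real, norm_smul, norm_smul,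
      real_inner_smul_left, real_inner_smul_right, h₁, h₃, Real.norm_of_nonneg (by positivity),
      Real.norm_of_nonneg (by positivity)]
    field_simp; ring
  have t₁ := tangent_le_one_div h₁₂ (add_pos hx hy)
  have t₂ := tangent_le_one_div h₁₃ hzx
  have t₃ := tangent_le_one_div h₂₃ (add_pos hy hz0)
  rw [hA2] at t₁
  rw [hB2] at t₂
  rw [hS2] at t₃
  set P := x * y / (2 * (x + y) ^ 3) with hP
  set Q := y * z / (2 * (y + z) ^ 3) with hQ
  set R := x * z / (2 * (z - x) ^ 3) with hR
  have hP0 : 0 < P := by positivity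
  have hQ0 : 0 < Q := by positivity
  have hR0 : 0 < R := by positivity
  have hPQR : R * (P + Q) ≤ P * Q := by
    have e : P * Q - R * (P + Q) =
        x * y * z / (4 * (x + y) ^ 3 * (y + z) ^ 3 * (z - x) ^ 3) * poly x y z := by
      rw [hP, hQ, hR, poly]; field_simp; ring
    have : 0 ≤ P * Q - R * (P + Q) := by rw [e]; positivity
    linarith
  have hform : R * B ^ 2 ≤ P * A ^ 2 + Q * S ^ 2 := by
    have h1 : R * B ^ 2 ≤ R * (A + S) ^ 2 := by gcongr
    have h2 : (P + Q) * (R * (A + S) ^ 2) ≤ (P + Q) * (P * A ^ 2 + Q * S ^ 2) := by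
      nlinarith [mul_le_mul_of_nonneg_right hPQR (sq_nonneg (A + S)), sq_nonneg (P * A - Q * S)]
    exact h1.trans (le_of_mul_le_mul_left h2 (by positivity))
  have e₁ : x * y * A ^ 2 / (2 * (x + y) ^ 3) = P * A ^ 2 := by rw [hP]; ring
  have e₂ : -(x * z * B ^ 2) / (2 * (z - x) ^ 3) = -(R * B ^ 2) := by rw [hR]; ring
  have e₃ : y * z * S ^ 2 / (2 * (y + z) ^ 3) = Q * S ^ 2 := by rw [hQ]; ring
  rw [e₁] at t₁
  rw [e₂] at t₂
  rw [e₃] at t₃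
  rw [collinearCost]
  linarith

/-! ### Elementary bounds for the polynomial -/

/-- Useful for small `x`: the subtracted term dominates all terms of the polynomial that contain
`x`. -/
lemma le_poly_of_small_first {x y z : ℝ} (hx : 0 ≤ x) (hxy : x ≤ y) (hyz : y ≤ z) :
    y * z * (z ^ 2 - y ^ 2) - 19 * x * z ^ 3 ≤ poly x y z := by
  have hy : 0 ≤ y := hx.trans hxy
  have hz : 0 ≤ z := hy.trans hyz
  obtain ⟨a, rfl⟩ := exists_add_of_le hxy
  obtain ⟨b, rfl⟩ := exists_add_of_le hyz
  have ha : 0 ≤ a := by linarith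
  have hb : 0 ≤ b := by linarith
  rw [← sub_nonneg]
  have : poly x (x + a) (x + a + b) - ((x + a) * (x + a + b) * ((x + a + b) ^ 2 - (x + a) ^ 2) -
      19 * x * (x + a + b) ^ 3) = x * ((x + a + b) ^ 3 * 18 - 6 * (x + a) * (x + a + b) ^ 2 -
      3 * (x + a) * (x + a + b) * a - (x + a) * (x ^ 2 + (x + a) ^ 2) - (x + a + b) *
      (3 * (x + a) ^ 2 + 3 * x * (x + a) + x ^ 2)) := by
    rw [poly]; ring
  rw [this]
  refine mul_nonneg hx ?_
  ring_nf
  positivity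

/-- Useful for large `z`: besides the leading term `(y - x) z³`, all terms are at most of order
`y² z²`. -/
lemma le_poly_of_large_third {x y z : ℝ} (hx : 0 ≤ x) (hxy : x ≤ y) (hyz : y ≤ z) :
    z ^ 2 * ((y - x) * z - 19 * y ^ 2) ≤ poly x y z := by
  have hy : 0 ≤ y := hx.trans hxy
  have hz : 0 ≤ z := hy.trans hyz
  obtain ⟨a, rfl⟩ := exists_add_of_le hxy
  obtain ⟨b, rfl⟩ := exists_add_of_le hyz
  have ha : 0 ≤ a := by linarith
  have hb : 0 ≤ b := by linarith
  rw [← sub_nonneg, poly]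
  ring_nf
  positivity

/-- Strict convexity of `t ↦ 1 / t`: pairing small with small and large with large is the more
expensive of the two pairings. -/
lemma cross_add_lt {a₁ a₂ b₁ b₂ : ℝ} (ha : a₁ < a₂) (hb : b₁ < b₂) (h : 0 < a₁ + b₁) :
    1 / (a₁ + b₂) + 1 / (a₂ + b₁) < 1 / (a₁ + b₁) + 1 / (a₂ + b₂) := by
  have h1 : 0 < a₁ + b₂ := by linarith
  have h2 : 0 < a₂ + b₁ := by linarith
  have h3 : 0 < a₂ + b₂ := by linarith
  have e : 1 / (a₁ + b₁) + 1 / (a₂ + b₂) - (1 / (a₁ + b₂) + 1 / (a₂ + b₁)) =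
      (a₂ - a₁) * (b₂ - b₁) * (a₁ + b₁ + a₂ + b₂) /
        ((a₁ + b₁) * (a₂ + b₂) * (a₁ + b₂) * (a₂ + b₁)) := by
    field_simp; ring
  have : 0 < 1 / (a₁ + b₁) + 1 / (a₂ + b₂) - (1 / (a₁ + b₂) + 1 / (a₂ + b₁)) := by
    rw [e]
    have := sub_pos.2 ha
    have := sub_pos.2 hb
    have : 0 < a₁ + b₁ + a₂ + b₂ := by linarith
    positivity
  linarith

/-! ### Improving a plan by a swap -/

/-- `σ₁` and `σ₂` send two points `p`, `q` to two points whose coordinates under `π` are those of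
`p` and `q`, either kept or exchanged, with the same choice for all `p` and `q`. -/
def SwapsCoord (π : ℝ × ℝ × ℝ → ℝ) (σ₁ σ₂ : (ℝ × ℝ × ℝ) × (ℝ × ℝ × ℝ) → ℝ × ℝ × ℝ) : Prop :=
  ((∀ w, π (σ₁ w) = π w.1) ∧ ∀ w, π (σ₂ w) = π w.2) ∨
    ((∀ w, π (σ₁ w) = π w.2) ∧ ∀ w, π (σ₂ w) = π w.1)

/-- The plan obtained from `γ` by taking mass away from `A` and `B` and putting it back at the
images under `σ₁` and `σ₂` of independent pairs of points of `A` and `B`. -/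
noncomputable def swapPlan (γ : Measure (ℝ × ℝ × ℝ)) (A B : Set (ℝ × ℝ × ℝ))
    (σ₁ σ₂ : (ℝ × ℝ × ℝ) × (ℝ × ℝ × ℝ) → ℝ × ℝ × ℝ) : Measure (ℝ × ℝ × ℝ) :=
  γ.restrict (A ∪ B)ᶜ + (1 - γ B) • γ.restrict A + (1 - γ A) • γ.restrict B +
    ((γ.restrict A).prod (γ.restrict B)).map σ₁ + ((γ.restrict A).prod (γ.restrict B)).map σ₂

lemma restrict_compl_add_add {γ : Measure (ℝ × ℝ × ℝ)} {A B : Set (ℝ × ℝ × ℝ)}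
    (hA : MeasurableSet A) (hB : MeasurableSet B) (hAB : Disjoint A B) :
    γ.restrict (A ∪ B)ᶜ + γ.restrict A + γ.restrict B = γ := by
  rw [add_assoc, ← Measure.restrict_union hAB hB, add_comm,
    Measure.restrict_add_restrict_compl (hA.union hB)]

lemma map_swapPlan {γ : Measure (ℝ × ℝ × ℝ)} [IsProbabilityMeasure γ] {A B : Set (ℝ × ℝ × ℝ)}
    (hA : MeasurableSet A) (hB : MeasurableSet B) (hAB : Disjoint A B)
    {σ₁ σ₂ : (ℝ × ℝ × ℝ) × (ℝ × ℝ × ℝ) → ℝ × ℝ × ℝ} (h₁ : Measurable σ₁) (h₂ : Measurable σ₂)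
    {π : ℝ × ℝ × ℝ → ℝ} (hπ : Measurable π) (hσ : SwapsCoord π σ₁ σ₂) :
    (swapPlan γ A B σ₁ σ₂).map π = γ.map π := by
  set α := γ.restrict A with hα
  set β := γ.restrict B with hβ
  have hf : (α.prod β).map (fun w => π w.1) = γ B • α.map π := by
    rw [← Function.comp_def π Prod.fst, ← Measure.map_map hπ measurable_fst, Measure.map_fst_prod,
      Measure.map_smul, hβ, Measure.restrict_apply_univ]
  have hs : (α.prod β).map (fun w => π w.2) = γ A • β.map π := by
    rw [← Function.comp_def π Prod.snd, ← Measure.map_map hπ measurable_snd, Measure.map_snd_prod,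
      Measure.map_smul, hα, Measure.restrict_apply_univ]
  have hsum : ((α.prod β).map σ₁).map π + ((α.prod β).map σ₂).map π =
      γ B • α.map π + γ A • β.map π := by
    rw [Measure.map_map hπ h₁, Measure.map_map hπ h₂]
    rcases hσ with ⟨e₁, e₂⟩ | ⟨e₁, e₂⟩
    · rw [show π ∘ σ₁ = fun w => π w.1 from funext e₁, show π ∘ σ₂ = fun w => π w.2 from funext e₂,
        hf, hs]
    · rw [show π ∘ σ₁ = fun w => π w.2 from funext e₁, show π ∘ σ₂ = fun w => π w.1 from funext e₂,
        hf, hs, add_comm]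
  rw [swapPlan, add_assoc, Measure.map_add _ _ hπ, Measure.map_add _ _ hπ, Measure.map_add _ _ hπ,
    Measure.map_add _ _ hπ, hsum, Measure.map_smul, Measure.map_smul]
  conv_rhs => rw [← restrict_compl_add_add (γ := γ) hA hB hAB]
  rw [Measure.map_add _ _ hπ, Measure.map_add _ _ hπ]
  have eA : α.map π = (1 - γ B) • α.map π + γ B • α.map π := by
    rw [← add_smul, tsub_add_cancel_of_le prob_le_one, one_smul]
  have eB : β.map π = (1 - γ A) • β.map π + γ A • β.map π := by
    rw [← add_smul, tsub_add_cancel_of_le prob_le_one, one_smul]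
  conv_rhs => rw [← hα, ← hβ, eA, eB]
  abel

lemma lintegral_map_prod_le (c : ℝ × ℝ × ℝ → ℝ≥0∞) {γ : Measure (ℝ × ℝ × ℝ)}
    [IsProbabilityMeasure γ] {A B : Set (ℝ × ℝ × ℝ)} (hA : MeasurableSet A) (hB : MeasurableSet B)
    {σ : (ℝ × ℝ × ℝ) × (ℝ × ℝ × ℝ) → ℝ × ℝ × ℝ} {k : ℝ≥0∞}
    (h : ∀ p ∈ A, ∀ q ∈ B, c (σ (p, q)) ≤ k) :
    ∫⁻ p, c p ∂(((γ.restrict A).prod (γ.restrict B)).map σ) ≤ k * (γ A * γ B) := by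
  refine (lintegral_map_le _ _).trans ?_
  rw [Measure.prod_restrict]
  refine (setLIntegral_mono' (hA.prod hB) (g := fun _ => k) fun w hw => h _ hw.1 _ hw.2).trans ?_
  rw [setLIntegral_const, Measure.prod_prod]

/-- No measurability of the cost is needed, because it is compared with constants on `A`, on `B`
and on the images of `A ×ˢ B`. -/
lemma not_isOptimalPlan_of_swap_on {ρ : Measure ℝ} [IsProbabilityMeasure ρ]
    {γ : Measure (ℝ × ℝ × ℝ)} (hγ : γ ∈ couplings ρ) (hfin : planCost γ ≠ ⊤)
    {A B : Set (ℝ × ℝ × ℝ)} (hA : MeasurableSet A) (hB : MeasurableSet B) (hAB : Disjoint A B)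
    (hA0 : 0 < γ A) (hB0 : 0 < γ B)
    {σ₁ σ₂ : (ℝ × ℝ × ℝ) × (ℝ × ℝ × ℝ) → ℝ × ℝ × ℝ} (h₁ : Measurable σ₁) (h₂ : Measurable σ₂)
    (hx : SwapsCoord (fun p => p.1) σ₁ σ₂) (hy : SwapsCoord (fun p => p.2.1) σ₁ σ₂)
    (hz : SwapsCoord (fun p => p.2.2) σ₁ σ₂) {a b a' b' : ℝ≥0∞}
    (ha : ∀ p ∈ A, a ≤ radialCost p.1 p.2.1 p.2.2) (hb : ∀ p ∈ B, b ≤ radialCost p.1 p.2.1 p.2.2)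
    (ha' : ∀ p ∈ A, ∀ q ∈ B,
      radialCost (σ₁ (p, q)).1 (σ₁ (p, q)).2.1 (σ₁ (p, q)).2.2 ≤ a')
    (hb' : ∀ p ∈ A, ∀ q ∈ B,
      radialCost (σ₂ (p, q)).1 (σ₂ (p, q)).2.1 (σ₂ (p, q)).2.2 ≤ b')
    (hlt : a' + b' < a + b) : ¬ IsOptimalPlan ρ γ := by
  have mx : Measurable fun p : ℝ × ℝ × ℝ => p.1 := by fun_prop
  have my : Measurable fun p : ℝ × ℝ × ℝ => p.2.1 := by fun_prop
  have mz : Measurable fun p : ℝ × ℝ × ℝ => p.2.2 := by fun_prop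
  have : IsProbabilityMeasure γ := ⟨by
    have := congrArg (fun μ => μ univ) hγ.1
    simpa [Measure.map_apply mx MeasurableSet.univ] using this⟩
  rintro ⟨-, hopt⟩
  refine absurd (hopt (swapPlan γ A B σ₁ σ₂) ⟨?_, ?_, ?_⟩) (not_le.2 ?_)
  · rw [map_swapPlan hA hB hAB h₁ h₂ mx hx, hγ.1]
  · rw [map_swapPlan hA hB hAB h₁ h₂ my hy, hγ.2.1]
  · rw [map_swapPlan hA hB hAB h₁ h₂ mz hz, hγ.2.2]
  set c : ℝ × ℝ × ℝ → ℝ≥0∞ := fun p => radialCost p.1 p.2.1 p.2.2 with hc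
  set CA := ∫⁻ p in A, c p ∂γ with hCA
  set CB := ∫⁻ p in B, c p ∂γ with hCB
  set C := ∫⁻ p in (A ∪ B)ᶜ, c p ∂γ with hC
  have htot : planCost γ = C + CA + CB := by
    rw [planCost, ← lintegral_add_measure, ← lintegral_add_measure,
      restrict_compl_add_add hA hB hAB]
  have hCA' : a * γ A ≤ CA := by
    rw [← setLIntegral_const]; exact setLIntegral_mono' hA ha
  have hCB' : b * γ B ≤ CB := by
    rw [← setLIntegral_const]; exact setLIntegral_mono' hB hb
  set R := C + (1 - γ B) * CA + (1 - γ A) * CB with hR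
  have hnew : planCost (swapPlan γ A B σ₁ σ₂) ≤ R + (a' + b') * (γ A * γ B) := by
    rw [planCost, swapPlan, lintegral_add_measure, lintegral_add_measure, lintegral_add_measure,
      lintegral_add_measure, lintegral_smul_measure, lintegral_smul_measure, add_mul, ← add_assoc]
    exact add_le_add (add_le_add le_rfl (lintegral_map_prod_le c hA hB ha'))
      (lintegral_map_prod_le c hA hB hb')
  have eA : CA = (1 - γ B) * CA + γ B * CA := by
    rw [← add_mul, tsub_add_cancel_of_le prob_le_one, one_mul]
  have eB : CB = (1 - γ A) * CB + γ A * CB := by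
    rw [← add_mul, tsub_add_cancel_of_le prob_le_one, one_mul]
  have hsplit : planCost γ = R + (γ B * CA + γ A * CB) := by
    rw [htot, hR]
    conv_lhs => rw [eA, eB]
    abel
  have hRfin : R ≠ ⊤ := fun h => hfin (by rw [hsplit, h, top_add])
  have hold : R + (a + b) * (γ A * γ B) ≤ planCost γ := by
    rw [hsplit]
    gcongr
    calc (a + b) * (γ A * γ B) = γ B * (a * γ A) + γ A * (b * γ B) := by ring
      _ ≤ _ := by gcongr
  refine (hnew.trans_lt ?_).trans_le hold
  refine ENNReal.add_lt_add_left hRfin ?_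
  exact (ENNReal.mul_lt_mul_iff_left (mul_ne_zero hA0.ne' hB0.ne')
    (ENNReal.mul_ne_top (measure_ne_top _ _) (measure_ne_top _ _))).2 hlt

/-- A plan of finite cost is not optimal if two points `P` and `Q` of its support can be replaced by
two cheaper ones that exchange some of their coordinates. The cost is bounded from below near
`P` and `Q`, and from above near the new points, by functions continuous there. -/
lemma not_isOptimalPlan_of_swap {ρ : Measure ℝ} [IsProbabilityMeasure ρ]
    {γ : Measure (ℝ × ℝ × ℝ)} (hγ : γ ∈ couplings ρ) (hfin : planCost γ ≠ ⊤)
    {P Q : ℝ × ℝ × ℝ} (hPQ : P ≠ Q) (hP : ∀ U ∈ 𝓝 P, 0 < γ U) (hQ : ∀ U ∈ 𝓝 Q, 0 < γ U)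
    {σ₁ σ₂ : (ℝ × ℝ × ℝ) × (ℝ × ℝ × ℝ) → ℝ × ℝ × ℝ} (h₁ : Continuous σ₁) (h₂ : Continuous σ₂)
    (hx : SwapsCoord (fun p => p.1) σ₁ σ₂) (hy : SwapsCoord (fun p => p.2.1) σ₁ σ₂)
    (hz : SwapsCoord (fun p => p.2.2) σ₁ σ₂) {L₁ L₂ H₁ H₂ : ℝ × ℝ × ℝ → ℝ}
    (cL₁ : ContinuousAt L₁ P) (cL₂ : ContinuousAt L₂ Q) (cH₁ : ContinuousAt H₁ (σ₁ (P, Q)))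
    (cH₂ : ContinuousAt H₂ (σ₂ (P, Q)))
    (hL₁ : ∀ᶠ p in 𝓝 P, ENNReal.ofReal (L₁ p) ≤ radialCost p.1 p.2.1 p.2.2)
    (hL₂ : ∀ᶠ p in 𝓝 Q, ENNReal.ofReal (L₂ p) ≤ radialCost p.1 p.2.1 p.2.2)
    (hH₁ : ∀ᶠ p in 𝓝 (σ₁ (P, Q)), radialCost p.1 p.2.1 p.2.2 ≤ ENNReal.ofReal (H₁ p))
    (hH₂ : ∀ᶠ p in 𝓝 (σ₂ (P, Q)), radialCost p.1 p.2.1 p.2.2 ≤ ENNReal.ofReal (H₂ p))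
    (pL₁ : 0 < L₁ P) (pL₂ : 0 < L₂ Q) (pH₁ : 0 ≤ H₁ (σ₁ (P, Q))) (pH₂ : 0 ≤ H₂ (σ₂ (P, Q)))
    (hlt : H₁ (σ₁ (P, Q)) + H₂ (σ₂ (P, Q)) < L₁ P + L₂ Q) : ¬ IsOptimalPlan ρ γ := by
  obtain ⟨ε, hε, hε₁, hε₂, hε₃⟩ : ∃ ε > 0, ε ≤ L₁ P ∧ ε ≤ L₂ Q ∧
      4 * ε < L₁ P + L₂ Q - (H₁ (σ₁ (P, Q)) + H₂ (σ₂ (P, Q))) := by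
    refine ⟨min (min (L₁ P) (L₂ Q)) ((L₁ P + L₂ Q - (H₁ (σ₁ (P, Q)) + H₂ (σ₂ (P, Q)))) / 5),
      lt_min (lt_min pL₁ pL₂) (by linarith), (min_le_left _ _).trans (min_le_left _ _),
      (min_le_left _ _).trans (min_le_right _ _), ?_⟩
    have := min_le_right (min (L₁ P) (L₂ Q))
      ((L₁ P + L₂ Q - (H₁ (σ₁ (P, Q)) + H₂ (σ₂ (P, Q)))) / 5)
    linarith
  have evP : ∀ᶠ p in 𝓝 P, ENNReal.ofReal (L₁ P - ε) ≤ radialCost p.1 p.2.1 p.2.2 := by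
    filter_upwards [hL₁, cL₁.eventually (lt_mem_nhds (sub_lt_self _ hε))] with p hp hp'
    exact (ENNReal.ofReal_le_ofReal hp'.le).trans hp
  have evQ : ∀ᶠ p in 𝓝 Q, ENNReal.ofReal (L₂ Q - ε) ≤ radialCost p.1 p.2.1 p.2.2 := by
    filter_upwards [hL₂, cL₂.eventually (lt_mem_nhds (sub_lt_self _ hε))] with p hp hp'
    exact (ENNReal.ofReal_le_ofReal hp'.le).trans hp
  have ev₁ : ∀ᶠ w in 𝓝 (P, Q), radialCost (σ₁ w).1 (σ₁ w).2.1 (σ₁ w).2.2 ≤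
      ENNReal.ofReal (H₁ (σ₁ (P, Q)) + ε) := by
    refine h₁.continuousAt.eventually (p := fun p : ℝ × ℝ × ℝ =>
      radialCost p.1 p.2.1 p.2.2 ≤ ENNReal.ofReal (H₁ (σ₁ (P, Q)) + ε)) ?_
    filter_upwards [hH₁, cH₁.eventually (gt_mem_nhds (lt_add_of_pos_right _ hε))] with p hp hp'
    exact hp.trans (ENNReal.ofReal_le_ofReal hp'.le)
  have ev₂ : ∀ᶠ w in 𝓝 (P, Q), radialCost (σ₂ w).1 (σ₂ w).2.1 (σ₂ w).2.2 ≤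
      ENNReal.ofReal (H₂ (σ₂ (P, Q)) + ε) := by
    refine h₂.continuousAt.eventually (p := fun p : ℝ × ℝ × ℝ =>
      radialCost p.1 p.2.1 p.2.2 ≤ ENNReal.ofReal (H₂ (σ₂ (P, Q)) + ε)) ?_
    filter_upwards [hH₂, cH₂.eventually (gt_mem_nhds (lt_add_of_pos_right _ hε))] with p hp hp'
    exact hp.trans (ENNReal.ofReal_le_ofReal hp'.le)
  obtain ⟨A₀, hA₀, B₀, hB₀, hAB₀⟩ := mem_nhds_prod_iff.1 (Filter.inter_mem ev₁ ev₂)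
  obtain ⟨U, V, hU, hV, hPU, hQV, hUV⟩ := t2_separation hPQ
  obtain ⟨A, hA, hAo, hPA⟩ := mem_nhds_iff.1
    (Filter.inter_mem (Filter.inter_mem evP hA₀) (hU.mem_nhds hPU))
  obtain ⟨B, hB, hBo, hQB⟩ := mem_nhds_iff.1
    (Filter.inter_mem (Filter.inter_mem evQ hB₀) (hV.mem_nhds hQV))
  refine not_isOptimalPlan_of_swap_on hγ hfin hAo.measurableSet hBo.measurableSet
    (hUV.mono (fun p hp => (hA hp).2) fun p hp => (hB hp).2) (hP A (hAo.mem_nhds hPA))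
    (hQ B (hBo.mem_nhds hQB)) h₁.measurable h₂.measurable hx hy hz
    (fun p hp => (hA hp).1.1) (fun p hp => (hB hp).1.1)
    (fun p hp q hq => (hAB₀ (mk_mem_prod (hA hp).1.2 (hB hq).1.2)).1)
    (fun p hp q hq => (hAB₀ (mk_mem_prod (hA hp).1.2 (hB hq).1.2)).2) ?_
  rw [← ENNReal.ofReal_add (by linarith) (by linarith),
    ← ENNReal.ofReal_add (by linarith) (by linarith)]
  exact (ENNReal.ofReal_lt_ofReal_iff (by linarith)).2 (by linarith)

/-! ### The distribution function and its inverse -/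

namespace IsPositiveRadial

variable {ρ : Measure ℝ} {s₁ s₂ : ℝ}

lemma distFun_eq_cdf (h : IsPositiveRadial ρ s₁ s₂) : distFun ρ = ProbabilityTheory.cdf ρ := by
  have := h.prob
  ext r
  rw [distFun, ProbabilityTheory.cdf_eq_real]
  refine congrArg ENNReal.toReal (le_antisymm (measure_mono fun x hx => hx.2.le) ?_)
  calc ρ (Iic r) ≤ ρ (Iio 0 ∪ {r} ∪ Ico 0 r) := measure_mono fun x hx => by
        rcases lt_or_ge x 0 with h0 | h0
        · exact Or.inl (Or.inl h0)
        · rcases eq_or_lt_of_le (show x ≤ r from hx) with h1 | h1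
          · exact Or.inl (Or.inr h1)
          · exact Or.inr ⟨h0, h1⟩
    _ ≤ ρ (Iio 0) + ρ {r} + ρ (Ico 0 r) :=
        (measure_union_le _ _).trans (add_le_add (measure_union_le _ _) le_rfl)
    _ = _ := by rw [h.halfLine, h.noAtoms, zero_add, zero_add]

lemma monotone_distFun (h : IsPositiveRadial ρ s₁ s₂) : Monotone (distFun ρ) := by
  rw [h.distFun_eq_cdf]; exact ProbabilityTheory.monotone_cdf ρ

lemma continuous_distFun (h : IsPositiveRadial ρ s₁ s₂) : Continuous (distFun ρ) := by
  have := h.prob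
  rw [h.distFun_eq_cdf]
  refine continuous_iff_continuousAt.2 fun x => ?_
  rw [(ProbabilityTheory.monotone_cdf ρ).continuousAt_iff_leftLim_eq_rightLim,
    StieltjesFunction.rightLim_eq]
  have h0 := h.noAtoms x
  rw [← ProbabilityTheory.measure_cdf ρ, StieltjesFunction.measure_singleton,
    ENNReal.ofReal_eq_zero] at h0
  exact le_antisymm ((ProbabilityTheory.monotone_cdf ρ).leftLim_le le_rfl) (by linarith)

lemma distFun_of_nonpos {x : ℝ} (hx : x ≤ 0) : distFun ρ x = 0 := by
  rw [distFun, Ico_eq_empty (not_lt.2 hx), measureReal_empty]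

lemma distFun_lt (h : IsPositiveRadial ρ s₁ s₂) {a b : ℝ} (ha : 0 ≤ a) (hab : a < b) :
    distFun ρ a < distFun ρ b := by
  have := h.prob
  have hd : Disjoint (Ico 0 a) (Ioo a b) :=
    Set.disjoint_left.2 fun x hx hx' => absurd hx.2 (not_lt.2 hx'.1.le)
  have h1 : ρ.real (Ico 0 a ∪ Ioo a b) = ρ.real (Ico 0 a) + ρ.real (Ioo a b) :=
    measureReal_union hd measurableSet_Ioo
  have h2 : ρ.real (Ico 0 a ∪ Ioo a b) ≤ ρ.real (Ico 0 b) :=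
    measureReal_mono (union_subset (Ico_subset_Ico_right hab.le) fun x hx =>
      ⟨ha.trans hx.1.le, hx.2⟩)
  have h3 : 0 < ρ.real (Ioo a b) :=
    ENNReal.toReal_pos (h.pos a b ha hab).ne' (measure_ne_top _ _)
  rw [distFun, distFun]
  linarith

lemma distFun_le_iff (h : IsPositiveRadial ρ s₁ s₂) {a b : ℝ} (hb : 0 ≤ b) :
    distFun ρ a ≤ distFun ρ b ↔ a ≤ b :=
  ⟨fun hle => not_lt.1 fun hlt => (h.distFun_lt hb hlt).not_ge hle,
    fun hle => h.monotone_distFun hle⟩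

lemma distFun_lt_one (h : IsPositiveRadial ρ s₁ s₂) (x : ℝ) : distFun ρ x < 1 := by
  have := h.prob
  calc distFun ρ x ≤ distFun ρ (max x 0) := h.monotone_distFun (le_max_left _ _)
    _ < distFun ρ (max x 0 + 1) := h.distFun_lt (le_max_right _ _) (lt_add_one _)
    _ ≤ 1 := measureReal_le_one

lemma distInv_distFun (h : IsPositiveRadial ρ s₁ s₂) {x : ℝ} (hx : 0 ≤ x) :
    distInv ρ (distFun ρ x) = x := by
  have : {r : ℝ | 0 ≤ r ∧ distFun ρ x ≤ distFun ρ r} = Ici x := by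
    ext r
    exact ⟨fun hr => (h.distFun_le_iff hr.1).1 hr.2,
      fun hr => ⟨hx.trans hr, h.monotone_distFun hr⟩⟩
  rw [distInv, this, csInf_Ici]

lemma exists_distFun_eq (h : IsPositiveRadial ρ s₁ s₂) {t : ℝ} (ht : t ∈ Ico (0 : ℝ) 1) :
    ∃ x, 0 ≤ x ∧ distFun ρ x = t := by
  have := h.prob
  have hlim : Tendsto (distFun ρ) atTop (𝓝 1) := by
    rw [h.distFun_eq_cdf]; exact ProbabilityTheory.tendsto_cdf_atTop ρ
  obtain ⟨b, hb, hb0⟩ := ((hlim.eventually (lt_mem_nhds ht.2)).and (eventually_ge_atTop 0)).exists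
  obtain ⟨x, hx, rfl⟩ := intermediate_value_Icc hb0 h.continuous_distFun.continuousOn
    (show t ∈ Icc (distFun ρ 0) (distFun ρ b) from
      ⟨by rw [distFun_of_nonpos le_rfl]; exact ht.1, hb.le⟩)
  exact ⟨x, hx.1, rfl⟩

lemma distInv_nonneg (t : ℝ) : 0 ≤ distInv ρ t := Real.sInf_nonneg fun _ hr => hr.1

lemma distFun_distInv (h : IsPositiveRadial ρ s₁ s₂) {t : ℝ} (ht : t ∈ Ico (0 : ℝ) 1) :
    distFun ρ (distInv ρ t) = t := by
  obtain ⟨x, hx, rfl⟩ := h.exists_distFun_eq ht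
  rw [h.distInv_distFun hx]

lemma le_distInv_iff (h : IsPositiveRadial ρ s₁ s₂) {a t : ℝ}
    (ht : t ∈ Ico (0 : ℝ) 1) : a ≤ distInv ρ t ↔ distFun ρ a ≤ t := by
  rw [← h.distFun_le_iff (distInv_nonneg t), h.distFun_distInv ht]

lemma distInv_le_iff (h : IsPositiveRadial ρ s₁ s₂) {a t : ℝ} (ha : 0 ≤ a)
    (ht : t ∈ Ico (0 : ℝ) 1) : distInv ρ t ≤ a ↔ t ≤ distFun ρ a := by
  rw [← h.distFun_le_iff ha, h.distFun_distInv ht]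

lemma strictMonoOn_distInv (h : IsPositiveRadial ρ s₁ s₂) :
    StrictMonoOn (distInv ρ) (Ico 0 1) := by
  intro s hs t ht hst
  rw [← not_le, h.le_distInv_iff hs, h.distFun_distInv ht]
  exact not_le.2 hst

lemma distInv_zero (h : IsPositiveRadial ρ s₁ s₂) : distInv ρ 0 = 0 := by
  simpa [distFun_of_nonpos] using h.distInv_distFun le_rfl

lemma distInv_of_one_le (h : IsPositiveRadial ρ s₁ s₂) {t : ℝ} (ht : 1 ≤ t) :
    distInv ρ t = 0 := by
  have : {r : ℝ | 0 ≤ r ∧ t ≤ distFun ρ r} = ∅ := by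
    ext r
    simpa using fun _ => (h.distFun_lt_one r).trans_le ht
  rw [distInv, this, Real.sInf_empty]

lemma distInv_of_nonpos {t : ℝ} (ht : t ≤ 0) :
    distInv ρ t = 0 := by
  refine le_antisymm (csInf_le ⟨0, fun r hr => hr.1⟩ ⟨le_rfl, ?_⟩) (distInv_nonneg t)
  rwa [distFun_of_nonpos le_rfl]

lemma measurable_distInv (h : IsPositiveRadial ρ s₁ s₂) : Measurable (distInv ρ) := by
  refine measurable_of_restrict_of_restrict_compl (s := Iio 1) measurableSet_Iio ?_ ?_
  · refine Monotone.measurable fun s t hst => ?_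
    rcases le_or_gt (s : ℝ) 0 with h0 | h0
    · simpa [distInv_of_nonpos h0] using distInv_nonneg (t : ℝ)
    · exact h.strictMonoOn_distInv.monotoneOn ⟨h0.le, s.2⟩ ⟨h0.le.trans hst, t.2⟩ hst
  · have : (Iio (1 : ℝ))ᶜ.domRestrict (distInv ρ) = fun _ => 0 := by
      ext t
      exact h.distInv_of_one_le (not_lt.1 t.2)
    rw [this]
    exact measurable_const

lemma continuousAt_distInv (h : IsPositiveRadial ρ s₁ s₂) {t : ℝ} (ht : t ∈ Ioo (0 : ℝ) 1) :
    ContinuousAt (distInv ρ) t := by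
  have hI : ∀ᶠ s in 𝓝 t, s ∈ Ico (0 : ℝ) 1 :=
    Eventually.mono (Ioo_mem_nhds ht.1 ht.2) fun s hs => ⟨hs.1.le, hs.2⟩
  have htI : t ∈ Ico (0 : ℝ) 1 := ⟨ht.1.le, ht.2⟩
  refine tendsto_order.2 ⟨fun a ha => ?_, fun b hb => ?_⟩
  · rcases lt_or_ge a 0 with h0 | h0
    · exact Eventually.of_forall fun s => h0.trans_le (distInv_nonneg s)
    · rw [← not_le, h.distInv_le_iff h0 htI, not_le] at ha
      filter_upwards [hI, lt_mem_nhds ha] with s hs hs'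
      rwa [← not_le, h.distInv_le_iff h0 hs, not_le]
  · rw [gt_iff_lt, ← not_le, h.le_distInv_iff htI, not_le] at hb
    filter_upwards [hI, gt_mem_nhds hb] with s hs hs'
    rwa [← not_le, h.le_distInv_iff hs, not_le]

lemma tendsto_distInv_zero (h : IsPositiveRadial ρ s₁ s₂) :
    Tendsto (distInv ρ) (𝓝[>] 0) (𝓝 0) := by
  refine tendsto_order.2 ⟨fun a ha => Eventually.of_forall fun s => ha.trans_le (distInv_nonneg s),
    fun b hb => ?_⟩
  have hFb : 0 < distFun ρ b := by simpa [distFun_of_nonpos] using h.distFun_lt le_rfl hb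
  filter_upwards [Ioo_mem_nhdsGT (lt_min hFb one_pos)] with s hs
  rw [← not_le, h.le_distInv_iff ⟨hs.1.le, hs.2.trans_le (min_le_right _ _)⟩, not_le]
  exact hs.2.trans_le (min_le_left _ _)

lemma tendsto_distInv_one (h : IsPositiveRadial ρ s₁ s₂) :
    Tendsto (distInv ρ) (𝓝[<] 1) atTop := by
  refine tendsto_atTop.2 fun b => ?_
  filter_upwards [Ioo_mem_nhdsLT (h.distFun_lt_one (max b 0))] with s hs
  exact (le_max_left _ _).trans ((h.le_distInv_iff
    ⟨measureReal_nonneg.trans hs.1.le, hs.2⟩).2 hs.1.le)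

lemma s₁_pos (h : IsPositiveRadial ρ s₁ s₂) : 0 < s₁ := by
  by_contra! h0
  have := h.mass₁
  rw [Ico_eq_empty (not_lt.2 h0), measure_empty] at this
  exact absurd this.symm (by simp)

lemma s₁_lt_s₂ (h : IsPositiveRadial ρ s₁ s₂) : s₁ < s₂ := by
  by_contra! h0
  have := h.mass₂
  rw [Ico_eq_empty (not_lt.2 h0), measure_empty] at this
  exact absurd this.symm (by simp)

lemma distFun_s₁ (h : IsPositiveRadial ρ s₁ s₂) : distFun ρ s₁ = 1 / 3 := by
  simp [distFun, Measure.real, h.mass₁]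

lemma distFun_s₂ (h : IsPositiveRadial ρ s₁ s₂) : distFun ρ s₂ = 2 / 3 := by
  have := h.prob
  rw [distFun, ← Ico_union_Ico_eq_Ico h.s₁_pos.le h.s₁_lt_s₂.le,
    measureReal_union (Set.disjoint_left.2 fun x hx hx' => absurd hx.2 (not_lt.2 hx'.1))
      measurableSet_Ico]
  simp only [Measure.real, h.mass₁, h.mass₂]
  norm_num

lemma distInv_third (h : IsPositiveRadial ρ s₁ s₂) : distInv ρ (1 / 3) = s₁ := by
  rw [← h.distFun_s₁, h.distInv_distFun h.s₁_pos.le]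

lemma distInv_two_thirds (h : IsPositiveRadial ρ s₁ s₂) : distInv ρ (2 / 3) = s₂ := by
  rw [← h.distFun_s₂, h.distInv_distFun (h.s₁_pos.trans h.s₁_lt_s₂).le]

/-- The distribution function sends `ρ` to the uniform measure, because `ρ` has no atoms. -/
lemma map_distFun (h : IsPositiveRadial ρ s₁ s₂) :
    ρ.map (distFun ρ) = volume.restrict (Ioo 0 1) := by
  have := h.prob
  have hm : Measurable (distFun ρ) := h.continuous_distFun.measurable
  have : IsProbabilityMeasure (ρ.map (distFun ρ)) :=
    Measure.isProbabilityMeasure_map hm.aemeasurable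
  refine Measure.ext_of_Iic _ _ fun t => ?_
  rw [Measure.map_apply hm measurableSet_Iic, Measure.restrict_apply measurableSet_Iic]
  rcases lt_or_ge t 0 with h0 | h0
  · have e₁ : distFun ρ ⁻¹' Iic t = ∅ := by
      ext x
      exact iff_of_false (not_le.2 (h0.trans_le measureReal_nonneg)) (notMem_empty x)
    have e₂ : Iic t ∩ Ioo 0 1 = ∅ := by
      ext x
      simp only [mem_inter_iff, mem_Iic, mem_Ioo, mem_empty_iff_false, iff_false]
      rintro ⟨h1, h2, -⟩
      linarith
    rw [e₁, e₂, measure_empty, measure_empty]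
  rcases lt_or_ge t 1 with h1 | h1
  · have e₁ : distFun ρ ⁻¹' Iic t = Iic (distInv ρ t) := by
      ext x
      rcases le_or_gt x 0 with hx | hx
      · simp [distFun_of_nonpos hx, h0, hx.trans (distInv_nonneg t)]
      · exact (h.le_distInv_iff ⟨h0, h1⟩).symm
    have e₂ : Iic t ∩ Ioo 0 1 = Ioc 0 t := by
      ext x
      exact ⟨fun hx => ⟨hx.2.1, hx.1⟩, fun hx => ⟨hx.2, hx.1, hx.2.trans_lt h1⟩⟩
    rw [e₁, e₂, Real.volume_Ioc, sub_zero, ← ProbabilityTheory.ofReal_cdf, ← h.distFun_eq_cdf,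
      h.distFun_distInv ⟨h0, h1⟩]
  · have e₁ : distFun ρ ⁻¹' Iic t = univ :=
      eq_univ_of_forall fun x => (h.distFun_lt_one x).le.trans h1
    have e₂ : Iic t ∩ Ioo 0 1 = Ioo 0 1 := inter_eq_right.2 fun x hx => hx.2.le.trans h1
    rw [e₁, e₂, measure_univ, Real.volume_Ioo]
    simp

lemma map_distInv (h : IsPositiveRadial ρ s₁ s₂) :
    (volume.restrict (Ioo 0 1)).map (distInv ρ) = ρ := by
  rw [← h.map_distFun, Measure.map_map h.measurable_distInv h.continuous_distFun.measurable]
  have : distInv ρ ∘ distFun ρ =ᵐ[ρ] id := by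
    have h0 : ∀ᵐ x ∂ρ, x ∉ Iio 0 := measure_eq_zero_iff_ae_notMem.1 h.halfLine
    filter_upwards [h0] with x hx
    exact h.distInv_distFun (not_lt.1 hx)
  rw [Measure.map_congr this, Measure.map_id]

end IsPositiveRadial

/-! ### The maps of the class in the coordinate given by the distribution function -/

/-- The map `letterMap ρ s₁ s₂ a b c` read in the coordinate `u = F x`: it exchanges the thirds of
the unit interval by translations and reflections. -/
noncomputable def letterShift (a b c : Letter) (u : ℝ) : ℝ :=
  if u < 1 / 3 then
    match a with
    | Letter.I => 1 / 3 + u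
    | Letter.D => 2 / 3 - u
  else if u < 2 / 3 then
    match b with
    | Letter.I => 1 / 3 + u
    | Letter.D => 4 / 3 - u
  else
    match c with
    | Letter.I => u - 2 / 3
    | Letter.D => 1 - u

lemma letterShift_I_first (b c : Letter) {u : ℝ} (hu : u < 1 / 3) :
    letterShift Letter.I b c u = 1 / 3 + u := by
  simp only [letterShift, if_pos hu]

lemma letterShift_D_first (b c : Letter) {u : ℝ} (hu : u < 1 / 3) :
    letterShift Letter.D b c u = 2 / 3 - u := by
  simp only [letterShift, if_pos hu]

lemma letterShift_I_second (a c : Letter) {u : ℝ} (hu : 1 / 3 ≤ u) (hu' : u < 2 / 3) :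
    letterShift a Letter.I c u = 1 / 3 + u := by
  simp only [letterShift, if_neg hu.not_gt, if_pos hu']

lemma letterShift_D_second (a c : Letter) {u : ℝ} (hu : 1 / 3 ≤ u) (hu' : u < 2 / 3) :
    letterShift a Letter.D c u = 4 / 3 - u := by
  simp only [letterShift, if_neg hu.not_gt, if_pos hu']

lemma letterShift_I_third (a b : Letter) {u : ℝ} (hu : 2 / 3 ≤ u) :
    letterShift a b Letter.I u = -(2 / 3) + u := by
  simp only [letterShift, if_neg (show ¬ u < 1 / 3 by linarith), if_neg hu.not_gt]
  ring

lemma letterShift_D_third (a b : Letter) {u : ℝ} (hu : 2 / 3 ≤ u) :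
    letterShift a b Letter.D u = 1 - u := by
  simp only [letterShift, if_neg (show ¬ u < 1 / 3 by linarith), if_neg hu.not_gt]

lemma measurable_letterShift (a b c : Letter) : Measurable (letterShift a b c) := by
  refine Measurable.ite measurableSet_Iio ?_ (Measurable.ite measurableSet_Iio ?_ ?_)
  · cases a <;> fun_prop
  · cases b <;> fun_prop
  · cases c <;> fun_prop

lemma map_add_restrict_Ioc (c p q : ℝ) :
    (volume.restrict (Ioc p q)).map (fun u => c + u) = volume.restrict (Ioc (c + p) (c + q)) := by
  have := (measurePreserving_add_left volume c).restrict_preimage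
    (measurableSet_Ioc (a := c + p) (b := c + q))
  rw [preimage_const_add_Ioc, add_sub_cancel_left, add_sub_cancel_left] at this
  exact this.map_eq

lemma map_sub_restrict_Ioc (c p q : ℝ) :
    (volume.restrict (Ioc p q)).map (fun u => c - u) = volume.restrict (Ioc (c - q) (c - p)) := by
  have := (Measure.measurePreserving_sub_left volume c).restrict_preimage
    (measurableSet_Ico (a := c - q) (b := c - p))
  rw [preimage_const_sub_Ico, sub_sub_cancel, sub_sub_cancel] at this
  rw [this.map_eq, restrict_Ico_eq_restrict_Ioc]

lemma map_restrict_Ioc_of_eqOn {s g : ℝ → ℝ} {p q : ℝ} (hsg : EqOn s g (Ioo p q)) :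
    (volume.restrict (Ioc p q)).map s = (volume.restrict (Ioc p q)).map g := by
  refine Measure.map_congr ?_
  rw [← restrict_Ioo_eq_restrict_Ioc]
  exact (ae_restrict_iff' measurableSet_Ioo).2 (Eventually.of_forall hsg)

lemma restrict_Ioo_eq_thirds : (volume : Measure ℝ).restrict (Ioo 0 1) =
    volume.restrict (Ioc 0 (1 / 3)) + volume.restrict (Ioc (1 / 3) (2 / 3)) +
      volume.restrict (Ioc (2 / 3) 1) := by
  have d : ∀ p q r : ℝ, Disjoint (Ioc p q) (Ioc q r) := fun p q r =>
    Set.disjoint_left.2 fun x hx hx' => absurd hx.2 (not_le.2 hx'.1)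
  rw [← Measure.restrict_union (d _ _ _) measurableSet_Ioc,
    Ioc_union_Ioc_eq_Ioc (by norm_num) (by norm_num),
    ← Measure.restrict_union (d _ _ _) measurableSet_Ioc,
    Ioc_union_Ioc_eq_Ioc (by norm_num) (by norm_num), restrict_Ioo_eq_restrict_Ioc]

lemma map_letterShift (a b c : Letter) :
    (volume.restrict (Ioo 0 1)).map (letterShift a b c) = volume.restrict (Ioo 0 1) := by
  have hm := measurable_letterShift a b c
  have e₁ : (volume.restrict (Ioc 0 (1 / 3))).map (letterShift a b c) =
      volume.restrict (Ioc (1 / 3) (2 / 3)) := by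
    cases a
    · rw [map_restrict_Ioc_of_eqOn fun u hu => letterShift_I_first b c hu.2, map_add_restrict_Ioc]
      norm_num
    · rw [map_restrict_Ioc_of_eqOn fun u hu => letterShift_D_first b c hu.2, map_sub_restrict_Ioc]
      norm_num
  have e₂ : (volume.restrict (Ioc (1 / 3) (2 / 3))).map (letterShift a b c) =
      volume.restrict (Ioc (2 / 3) 1) := by
    cases b
    · rw [map_restrict_Ioc_of_eqOn fun u hu => letterShift_I_second a c hu.1.le hu.2,
        map_add_restrict_Ioc]
      norm_num
    · rw [map_restrict_Ioc_of_eqOn fun u hu => letterShift_D_second a c hu.1.le hu.2,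
        map_sub_restrict_Ioc]
      norm_num
  have e₃ : (volume.restrict (Ioc (2 / 3) 1)).map (letterShift a b c) =
      volume.restrict (Ioc 0 (1 / 3)) := by
    cases c
    · rw [map_restrict_Ioc_of_eqOn fun u hu => letterShift_I_third a b hu.1.le,
        map_add_restrict_Ioc]
      norm_num
    · rw [map_restrict_Ioc_of_eqOn fun u hu => letterShift_D_third a b hu.1.le,
        map_sub_restrict_Ioc]
      norm_num
  rw [restrict_Ioo_eq_thirds, Measure.map_add _ _ hm, Measure.map_add _ _ hm, e₁, e₂, e₃]
  abel

namespace IsPositiveRadial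

variable {ρ : Measure ℝ} {s₁ s₂ : ℝ}

lemma letterMap_distInv (h : IsPositiveRadial ρ s₁ s₂) (a b c : Letter) {u : ℝ}
    (hu : u ∈ Ico (0 : ℝ) 1) :
    letterMap ρ s₁ s₂ a b c (distInv ρ u) = distInv ρ (letterShift a b c u) := by
  have i₁ : distInv ρ u < s₁ ↔ u < 1 / 3 := by
    rw [← not_le, h.le_distInv_iff hu, h.distFun_s₁, not_le]
  have i₂ : distInv ρ u < s₂ ↔ u < 2 / 3 := by
    rw [← not_le, h.le_distInv_iff hu, h.distFun_s₂, not_le]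
  unfold letterMap letterShift
  simp only [i₁, i₂, h.distFun_distInv hu]
  split_ifs
  · cases a <;> rfl
  · cases b <;> rfl
  · cases c <;> rfl

lemma measurable_letterMap (h : IsPositiveRadial ρ s₁ s₂) (a b c : Letter) :
    Measurable (letterMap ρ s₁ s₂ a b c) := by
  have hF := h.continuous_distFun.measurable
  have hG := h.measurable_distInv
  refine Measurable.ite measurableSet_Iio ?_ (Measurable.ite measurableSet_Iio ?_ ?_)
  · cases a <;> exact hG.comp (by fun_prop)
  · cases b <;> exact hG.comp (by fun_prop)
  · cases c <;> exact hG.comp (by fun_prop)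

lemma map_letterMap (h : IsPositiveRadial ρ s₁ s₂) (a b c : Letter) :
    ρ.map (letterMap ρ s₁ s₂ a b c) = ρ := by
  have hG := h.measurable_distInv
  set S := letterMap ρ s₁ s₂ a b c with hS
  have hae : S ∘ distInv ρ =ᵐ[volume.restrict (Ioo 0 1)] distInv ρ ∘ letterShift a b c :=
    (ae_restrict_iff' measurableSet_Ioo).2 (Eventually.of_forall fun u hu =>
      h.letterMap_distInv a b c ⟨hu.1.le, hu.2⟩)
  calc ρ.map S = ((volume.restrict (Ioo 0 1)).map (distInv ρ)).map S := by rw [h.map_distInv]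
    _ = ((volume.restrict (Ioo 0 1)).map (letterShift a b c)).map (distInv ρ) := by
        rw [Measure.map_map (h.measurable_letterMap a b c) hG, Measure.map_congr hae,
          ← Measure.map_map hG (measurable_letterShift a b c)]
    _ = ρ := by rw [map_letterShift, h.map_distInv]

lemma mongePlan_mem_couplings (h : IsPositiveRadial ρ s₁ s₂) (a b c : Letter) :
    mongePlan ρ (letterMap ρ s₁ s₂ a b c) ∈ couplings ρ := by
  have hS := h.measurable_letterMap a b c
  have hm : Measurable fun x => (x, letterMap ρ s₁ s₂ a b c x,
    letterMap ρ s₁ s₂ a b c (letterMap ρ s₁ s₂ a b c x)) := by fun_prop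
  refine ⟨?_, ?_, ?_⟩
  · rw [mongePlan, Measure.map_map (by fun_prop) hm]
    exact Measure.map_id
  · rw [mongePlan, Measure.map_map (by fun_prop) hm]
    exact h.map_letterMap a b c
  · rw [mongePlan, Measure.map_map (by fun_prop) hm]
    change ρ.map (letterMap ρ s₁ s₂ a b c ∘ letterMap ρ s₁ s₂ a b c) = ρ
    rw [← Measure.map_map hS hS, h.map_letterMap, h.map_letterMap]

end IsPositiveRadial

/-! ### No word gives an optimal plan -/

lemma letterShift_mem_second (a b c : Letter) {u : ℝ} (hu : u ∈ Ioo (0 : ℝ) (1 / 3)) :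
    letterShift a b c u ∈ Ioo (1 / 3 : ℝ) (2 / 3) := by
  obtain ⟨h₁, h₂⟩ := hu
  cases a
  · rw [letterShift_I_first b c h₂]; constructor <;> linarith
  · rw [letterShift_D_first b c h₂]; constructor <;> linarith

lemma letterShift_mem_third (a b c : Letter) {u : ℝ} (hu : u ∈ Ioo (1 / 3 : ℝ) (2 / 3)) :
    letterShift a b c u ∈ Ioo (2 / 3 : ℝ) 1 := by
  obtain ⟨h₁, h₂⟩ := hu
  cases b
  · rw [letterShift_I_second a c h₁.le h₂]; constructor <;> linarith
  · rw [letterShift_D_second a c h₁.le h₂]; constructor <;> linarith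

lemma SwapsCoord.of_both {π : ℝ × ℝ × ℝ → ℝ}
    {σ₁ σ₂ : (ℝ × ℝ × ℝ) × (ℝ × ℝ × ℝ) → ℝ × ℝ × ℝ} (h : SwapsCoord π σ₁ σ₂) {I : Set ℝ}
    {P Q : ℝ × ℝ × ℝ} (hP : π P ∈ I) (hQ : π Q ∈ I) :
    π (σ₁ (P, Q)) ∈ I ∧ π (σ₂ (P, Q)) ∈ I := by
  rcases h with ⟨h₁, h₂⟩ | ⟨h₁, h₂⟩
  · rw [h₁, h₂]; exact ⟨hP, hQ⟩
  · rw [h₁, h₂]; exact ⟨hQ, hP⟩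

lemma continuousAt_collinearCost {p : ℝ × ℝ × ℝ} (h₁ : 0 < p.1 + p.2.1) (h₂ : 0 < p.2.2 - p.1)
    (h₃ : 0 < p.2.1 + p.2.2) :
    ContinuousAt (fun p : ℝ × ℝ × ℝ => collinearCost p.1 p.2.1 p.2.2) p := by
  unfold collinearCost
  have c₁ : ContinuousAt (fun p : ℝ × ℝ × ℝ => p.1 + p.2.1) p := by fun_prop
  have c₂ : ContinuousAt (fun p : ℝ × ℝ × ℝ => p.2.2 - p.1) p := by fun_prop
  have c₃ : ContinuousAt (fun p : ℝ × ℝ × ℝ => p.2.1 + p.2.2) p := by fun_prop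
  exact ((continuousAt_const.div c₁ h₁.ne').add (continuousAt_const.div c₂ h₂.ne')).add
    (continuousAt_const.div c₃ h₃.ne')

lemma collinearCost_pos {x y z : ℝ} (hx : 0 < x) (hy : 0 < y) (hz : x < z) :
    0 < collinearCost x y z := by
  have : 0 < z := hx.trans hz
  have : 0 < z - x := sub_pos.2 hz
  unfold collinearCost
  positivity

lemma eventually_pos_and_lt {p : ℝ × ℝ × ℝ} (hx : 0 < p.1) (hy : 0 < p.2.1)
    (hz : p.1 < p.2.2) : ∀ᶠ q in 𝓝 p, 0 < q.1 ∧ 0 < q.2.1 ∧ q.1 < q.2.2 := by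
  have c₁ : ContinuousAt (fun p : ℝ × ℝ × ℝ => p.1) p := by fun_prop
  have c₂ : ContinuousAt (fun p : ℝ × ℝ × ℝ => p.2.1) p := by fun_prop
  have c₃ : ContinuousAt (fun p : ℝ × ℝ × ℝ => p.2.2) p := by fun_prop
  exact (c₁.eventually (lt_mem_nhds hx)).and
    ((c₂.eventually (lt_mem_nhds hy)).and (c₁.eventually_lt c₃ hz))

lemma eventually_radialCost_le_collinearCost {p : ℝ × ℝ × ℝ} (hx : 0 < p.1) (hy : 0 < p.2.1)
    (hz : p.1 < p.2.2) : ∀ᶠ q in 𝓝 p, radialCost q.1 q.2.1 q.2.2 ≤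
      ENNReal.ofReal (collinearCost q.1 q.2.1 q.2.2) := by
  filter_upwards [eventually_pos_and_lt hx hy hz] with q hq
  exact radialCost_le_collinearCost hq.1.le hq.2.1 hq.2.2

lemma eventually_collinearCost_le_radialCost {p : ℝ × ℝ × ℝ} (hx : 0 < p.1) (hy : 0 < p.2.1)
    (hz : p.1 < p.2.2) (hp : 0 < poly p.1 p.2.1 p.2.2) : ∀ᶠ q in 𝓝 p,
      ENNReal.ofReal (collinearCost q.1 q.2.1 q.2.2) ≤ radialCost q.1 q.2.1 q.2.2 := by
  have c : ContinuousAt (fun p : ℝ × ℝ × ℝ => poly p.1 p.2.1 p.2.2) p := by unfold poly; fun_prop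
  filter_upwards [eventually_pos_and_lt hx hy hz, c.eventually (lt_mem_nhds hp)] with q hq hq'
  exact collinearCost_le_radialCost hq.1 hq.2.1 hq.2.2 hq'.le

/-- A swap between two points of the support at which the collinear configuration is the cheapest
one: it is enough that the swap lowers the collinear cost. -/
lemma not_isOptimalPlan_of_collinear_swap {ρ : Measure ℝ} [IsProbabilityMeasure ρ]
    {γ : Measure (ℝ × ℝ × ℝ)} (hγ : γ ∈ couplings ρ) (hfin : planCost γ ≠ ⊤) {s₁ s₂ : ℝ}
    (hs₁ : 0 < s₁) (hs : s₁ < s₂) {P Q : ℝ × ℝ × ℝ} (hPQ : P ≠ Q)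
    (hPs : ∀ U ∈ 𝓝 P, 0 < γ U) (hQs : ∀ U ∈ 𝓝 Q, 0 < γ U)
    {σ₁ σ₂ : (ℝ × ℝ × ℝ) × (ℝ × ℝ × ℝ) → ℝ × ℝ × ℝ} (h₁ : Continuous σ₁) (h₂ : Continuous σ₂)
    (hx : SwapsCoord (fun p => p.1) σ₁ σ₂) (hy : SwapsCoord (fun p => p.2.1) σ₁ σ₂)
    (hz : SwapsCoord (fun p => p.2.2) σ₁ σ₂)
    (xP : P.1 ∈ Ioo 0 s₁) (xQ : Q.1 ∈ Ioo 0 s₁) (yP : P.2.1 ∈ Ioo s₁ s₂) (yQ : Q.2.1 ∈ Ioo s₁ s₂)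
    (zP : P.2.2 ∈ Ioi s₂) (zQ : Q.2.2 ∈ Ioi s₂)
    (pP : 0 < poly P.1 P.2.1 P.2.2) (pQ : 0 < poly Q.1 Q.2.1 Q.2.2)
    (hlt : collinearCost (σ₁ (P, Q)).1 (σ₁ (P, Q)).2.1 (σ₁ (P, Q)).2.2 +
      collinearCost (σ₂ (P, Q)).1 (σ₂ (P, Q)).2.1 (σ₂ (P, Q)).2.2 <
      collinearCost P.1 P.2.1 P.2.2 + collinearCost Q.1 Q.2.1 Q.2.2) :
    ¬ IsOptimalPlan ρ γ := by
  have key : ∀ p : ℝ × ℝ × ℝ, p.1 ∈ Ioo 0 s₁ → p.2.1 ∈ Ioo s₁ s₂ → p.2.2 ∈ Ioi s₂ →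
      0 < p.1 ∧ 0 < p.2.1 ∧ p.1 < p.2.2 := fun p hx hy hz =>
    ⟨hx.1, hs₁.trans hy.1, hx.2.trans (hs.trans hz)⟩
  have kc : ∀ p : ℝ × ℝ × ℝ, 0 < p.1 ∧ 0 < p.2.1 ∧ p.1 < p.2.2 →
      ContinuousAt (fun p : ℝ × ℝ × ℝ => collinearCost p.1 p.2.1 p.2.2) p := fun p hp =>
    continuousAt_collinearCost (add_pos hp.1 hp.2.1) (sub_pos.2 hp.2.2)
      (add_pos hp.2.1 (hp.1.trans hp.2.2))
  have kP := key P xP yP zP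
  have kQ := key Q xQ yQ zQ
  have k₁ := key (σ₁ (P, Q)) (hx.of_both xP xQ).1 (hy.of_both yP yQ).1 (hz.of_both zP zQ).1
  have k₂ := key (σ₂ (P, Q)) (hx.of_both xP xQ).2 (hy.of_both yP yQ).2 (hz.of_both zP zQ).2
  exact not_isOptimalPlan_of_swap hγ hfin hPQ hPs hQs h₁ h₂ hx hy hz (kc P kP) (kc Q kQ)
    (kc _ k₁) (kc _ k₂)
    (eventually_collinearCost_le_radialCost kP.1 kP.2.1 kP.2.2 pP)
    (eventually_collinearCost_le_radialCost kQ.1 kQ.2.1 kQ.2.2 pQ)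
    (eventually_radialCost_le_collinearCost k₁.1 k₁.2.1 k₁.2.2)
    (eventually_radialCost_le_collinearCost k₂.1 k₂.2.1 k₂.2.2)
    (collinearCost_pos kP.1 kP.2.1 kP.2.2) (collinearCost_pos kQ.1 kQ.2.1 kQ.2.2)
    (collinearCost_pos k₁.1 k₁.2.1 k₁.2.2).le (collinearCost_pos k₂.1 k₂.2.1 k₂.2.2).le hlt

namespace IsPositiveRadial

variable {ρ : Measure ℝ} {s₁ s₂ : ℝ}

lemma letterMap_nonneg (a b c : Letter) (x : ℝ) : 0 ≤ letterMap ρ s₁ s₂ a b c x := by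
  unfold letterMap
  split_ifs
  · cases a <;> exact distInv_nonneg _
  · cases b <;> exact distInv_nonneg _
  · cases c <;> exact distInv_nonneg _

lemma s₁_le_distInv (h : IsPositiveRadial ρ s₁ s₂) {t : ℝ} (h₁ : 1 / 3 ≤ t) (h₂ : t < 1) :
    s₁ ≤ distInv ρ t := by
  rwa [h.le_distInv_iff ⟨by linarith, h₂⟩, h.distFun_s₁]

lemma distInv_mem_first (h : IsPositiveRadial ρ s₁ s₂) {t : ℝ} (ht : t ∈ Ioo (0 : ℝ) (1 / 3)) :
    distInv ρ t ∈ Ioo 0 s₁ := by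
  rw [← h.distInv_third, ← h.distInv_zero]
  have hI : t ∈ Ico (0 : ℝ) 1 := ⟨ht.1.le, ht.2.trans (by norm_num)⟩
  exact ⟨h.strictMonoOn_distInv (by norm_num) hI ht.1,
    h.strictMonoOn_distInv hI (by norm_num) ht.2⟩

lemma distInv_mem_second (h : IsPositiveRadial ρ s₁ s₂) {t : ℝ}
    (ht : t ∈ Ioo (1 / 3 : ℝ) (2 / 3)) : distInv ρ t ∈ Ioo s₁ s₂ := by
  rw [← h.distInv_third, ← h.distInv_two_thirds]
  have hI : t ∈ Ico (0 : ℝ) 1 := ⟨by linarith [ht.1], by linarith [ht.2]⟩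
  exact ⟨h.strictMonoOn_distInv (by norm_num) hI ht.1,
    h.strictMonoOn_distInv hI (by norm_num) ht.2⟩

lemma distInv_mem_third (h : IsPositiveRadial ρ s₁ s₂) {t : ℝ}
    (ht : t ∈ Ioo (2 / 3 : ℝ) 1) : distInv ρ t ∈ Ioi s₂ := by
  rw [← h.distInv_two_thirds]
  exact h.strictMonoOn_distInv (by norm_num) ⟨by linarith [ht.1], ht.2⟩ ht.1

lemma s₁_le_letterMap (h : IsPositiveRadial ρ s₁ s₂) (a b c : Letter) {x : ℝ} (hx : 0 ≤ x)
    (hx' : x < s₁) : s₁ ≤ letterMap ρ s₁ s₂ a b c x := by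
  have h0 : 0 ≤ distFun ρ x := measureReal_nonneg
  have h1 : distFun ρ x < 1 / 3 := by rw [← h.distFun_s₁]; exact h.distFun_lt hx hx'
  unfold letterMap
  rw [if_pos hx']
  cases a <;> exact h.s₁_le_distInv (by linarith) (by linarith)

lemma letterMap_letterMap_distInv (h : IsPositiveRadial ρ s₁ s₂) (a b c : Letter) {u : ℝ}
    (hu : u ∈ Ioo (0 : ℝ) (1 / 3)) :
    letterMap ρ s₁ s₂ a b c (letterMap ρ s₁ s₂ a b c (distInv ρ u)) =
      distInv ρ (letterShift a b c (letterShift a b c u)) := by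
  have hu' := letterShift_mem_second a b c hu
  rw [h.letterMap_distInv a b c ⟨hu.1.le, by linarith [hu.2]⟩,
    h.letterMap_distInv a b c ⟨by linarith [hu'.1], by linarith [hu'.2]⟩]

/-- Along an orbit at least two of the three points lie beyond `s₁`, so the cost is bounded. -/
lemma planCost_mongePlan_ne_top (h : IsPositiveRadial ρ s₁ s₂) (a b c : Letter) :
    planCost (mongePlan ρ (letterMap ρ s₁ s₂ a b c)) ≠ ⊤ := by
  have := h.prob
  set S := letterMap ρ s₁ s₂ a b c with hS
  have hae : ∀ᵐ x ∂ρ, radialCost x (S x) (S (S x)) ≤ ENNReal.ofReal (3 / s₁) := by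
    have h0 : ∀ᵐ x ∂ρ, x ∉ Iio 0 := measure_eq_zero_iff_ae_notMem.1 h.halfLine
    have h0' : ∀ᵐ x ∂ρ, x ∉ ({0} : Set ℝ) := measure_eq_zero_iff_ae_notMem.1 (h.noAtoms 0)
    filter_upwards [h0, h0'] with x hx hx'
    have hx0 : 0 < x := lt_of_le_of_ne (not_lt.1 hx) (Ne.symm hx')
    refine radialCost_le_three_div h.s₁_pos hx0.le (letterMap_nonneg a b c _)
      (letterMap_nonneg a b c _) ?_
    rcases lt_or_ge x s₁ with h1 | h1
    · refine Or.inr (Or.inr ⟨h.s₁_le_letterMap a b c hx0.le h1, ?_⟩)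
      have hu : distFun ρ x ∈ Ioo (0 : ℝ) (1 / 3) := by
        rw [← h.distFun_s₁, ← distFun_of_nonpos (ρ := ρ) le_rfl]
        exact ⟨h.distFun_lt le_rfl hx0, h.distFun_lt hx0.le h1⟩
      have hw := letterShift_mem_third a b c (letterShift_mem_second a b c hu)
      have := h.letterMap_letterMap_distInv a b c hu
      rw [h.distInv_distFun hx0.le] at this
      rw [hS, this]
      exact h.s₁_le_distInv (by linarith [hw.1]) hw.2
    · rcases lt_or_ge (S x) s₁ with h2 | h2
      · exact Or.inr (Or.inl ⟨h1, h.s₁_le_letterMap a b c (letterMap_nonneg a b c _) h2⟩)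
      · exact Or.inl ⟨h1, h2⟩
  refine ne_top_of_le_ne_top (ENNReal.ofReal_ne_top (r := 3 / s₁)) ?_
  calc planCost (mongePlan ρ S) ≤ ∫⁻ x, radialCost x (S x) (S (S x)) ∂ρ := lintegral_map_le _ _
    _ ≤ ∫⁻ _, ENNReal.ofReal (3 / s₁) ∂ρ := lintegral_mono_ae hae
    _ = ENNReal.ofReal (3 / s₁) := by simp

/-- The points `(x, S x, S² x)` with `x` in the first third belong to the support of the plan. -/
lemma mongePlan_pos_of_mem_nhds (h : IsPositiveRadial ρ s₁ s₂) {a b c : Letter} {α β : ℝ → ℝ}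
    (cα : Continuous α) (cβ : Continuous β)
    (hα : ∀ u ∈ Ioo (0 : ℝ) (1 / 3), letterShift a b c u = α u)
    (hβ : ∀ u ∈ Ioo (0 : ℝ) (1 / 3), letterShift a b c (α u) = β u)
    {u₀ : ℝ} (hu₀ : u₀ ∈ Ioo (0 : ℝ) (1 / 3)) :
    ∀ U ∈ 𝓝 (distInv ρ u₀, distInv ρ (α u₀), distInv ρ (β u₀)),
      0 < mongePlan ρ (letterMap ρ s₁ s₂ a b c) U := by
  intro U hU
  obtain ⟨V, hVU, hV, hPV⟩ := mem_nhds_iff.1 hU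
  refine lt_of_lt_of_le ?_ (measure_mono hVU)
  set S := letterMap ρ s₁ s₂ a b c with hS
  have hSm : Measurable S := h.measurable_letterMap a b c
  have hm : Measurable fun x => (x, S x, S (S x)) := by fun_prop
  rw [mongePlan, ← h.map_distInv, Measure.map_map hm h.measurable_distInv,
    Measure.map_apply (hm.comp h.measurable_distInv) hV.measurableSet]
  have mα := letterShift_mem_second a b c hu₀
  have mβ := letterShift_mem_third a b c mα
  rw [hα u₀ hu₀] at mα mβ
  rw [hβ u₀ hu₀] at mβ
  have hc : ContinuousAt (fun u => (distInv ρ u, distInv ρ (α u), distInv ρ (β u))) u₀ :=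
    (h.continuousAt_distInv ⟨hu₀.1, by linarith [hu₀.2]⟩).prodMk
      (((h.continuousAt_distInv ⟨by linarith [mα.1], by linarith [mα.2]⟩).comp
        cα.continuousAt).prodMk
      ((h.continuousAt_distInv ⟨by linarith [mβ.1], by linarith [mβ.2]⟩).comp cβ.continuousAt))
  have hev : ((fun x => (x, S x, S (S x))) ∘ distInv ρ) ⁻¹' V ∩ Ioo 0 1 ∈ 𝓝 u₀ := by
    filter_upwards [hc (hV.mem_nhds hPV), Ioo_mem_nhds hu₀.1 hu₀.2] with u hu hu'
    refine ⟨?_, hu'.1, by linarith [hu'.2]⟩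
    have e₂ := h.letterMap_letterMap_distInv a b c hu'
    have e₁ := h.letterMap_distInv a b c (u := u) ⟨hu'.1.le, by linarith [hu'.2]⟩
    rw [hα u hu'] at e₁ e₂
    rw [hβ u hu'] at e₂
    simp only [mem_preimage, Function.comp_apply, hS]
    rw [e₂, e₁]
    exact hu
  rw [Measure.restrict_apply ((hm.comp h.measurable_distInv) hV.measurableSet)]
  exact Measure.measure_pos_of_mem_nhds _ hev

/-- If the polynomial is positive on the branch `(G u, G (α u), G (β u))` near `u = 0`, a swap that
lowers the collinear cost of every pair of its points excludes optimality. -/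
lemma not_isOptimalPlan_of_branch (h : IsPositiveRadial ρ s₁ s₂) {a b c : Letter} {α β : ℝ → ℝ}
    (cα : Continuous α) (cβ : Continuous β)
    (hα : ∀ u ∈ Ioo (0 : ℝ) (1 / 3), letterShift a b c u = α u)
    (hβ : ∀ u ∈ Ioo (0 : ℝ) (1 / 3), letterShift a b c (α u) = β u)
    {σ₁ σ₂ : (ℝ × ℝ × ℝ) × (ℝ × ℝ × ℝ) → ℝ × ℝ × ℝ} (h₁ : Continuous σ₁) (h₂ : Continuous σ₂)
    (hx : SwapsCoord (fun p => p.1) σ₁ σ₂) (hy : SwapsCoord (fun p => p.2.1) σ₁ σ₂)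
    (hz : SwapsCoord (fun p => p.2.2) σ₁ σ₂)
    (hpoly : ∀ᶠ u in 𝓝[>] (0 : ℝ), 0 < poly (distInv ρ u) (distInv ρ (α u)) (distInv ρ (β u)))
    (hlt : ∀ P Q : ℝ × ℝ × ℝ, ∀ u ∈ Ioo (0 : ℝ) (1 / 3), ∀ v ∈ Ioo (0 : ℝ) (1 / 3), u < v →
      P = (distInv ρ u, distInv ρ (α u), distInv ρ (β u)) →
      Q = (distInv ρ v, distInv ρ (α v), distInv ρ (β v)) →
      collinearCost (σ₁ (P, Q)).1 (σ₁ (P, Q)).2.1 (σ₁ (P, Q)).2.2 +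
        collinearCost (σ₂ (P, Q)).1 (σ₂ (P, Q)).2.1 (σ₂ (P, Q)).2.2 <
        collinearCost P.1 P.2.1 P.2.2 + collinearCost Q.1 Q.2.1 Q.2.2) :
    ¬ IsOptimalPlan ρ (mongePlan ρ (letterMap ρ s₁ s₂ a b c)) := by
  have := h.prob
  obtain ⟨δ, hδ, hδp⟩ := mem_nhdsGT_iff_exists_Ioo_subset.1
    (Filter.inter_mem hpoly (Ioo_mem_nhdsGT (show (0 : ℝ) < 1 / 3 by norm_num)))
  have hδ0 : 0 < δ := hδ
  have mu : δ / 3 ∈ Ioo 0 δ := ⟨by linarith, by linarith⟩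
  have mv : δ / 2 ∈ Ioo 0 δ := ⟨by linarith, by linarith⟩
  obtain ⟨pu, hu⟩ := hδp mu
  obtain ⟨pv, hv⟩ := hδp mv
  have mα : ∀ u ∈ Ioo (0 : ℝ) (1 / 3), α u ∈ Ioo (1 / 3 : ℝ) (2 / 3) := fun u hu => by
    rw [← hα u hu]; exact letterShift_mem_second a b c hu
  have mβ : ∀ u ∈ Ioo (0 : ℝ) (1 / 3), β u ∈ Ioo (2 / 3 : ℝ) 1 := fun u hu => by
    rw [← hβ u hu]; exact letterShift_mem_third a b c (mα u hu)
  refine not_isOptimalPlan_of_collinear_swap (h.mongePlan_mem_couplings a b c)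
    (h.planCost_mongePlan_ne_top a b c) h.s₁_pos h.s₁_lt_s₂
    (P := (distInv ρ (δ / 3), distInv ρ (α (δ / 3)), distInv ρ (β (δ / 3))))
    (Q := (distInv ρ (δ / 2), distInv ρ (α (δ / 2)), distInv ρ (β (δ / 2)))) ?_
    (h.mongePlan_pos_of_mem_nhds cα cβ hα hβ hu) (h.mongePlan_pos_of_mem_nhds cα cβ hα hβ hv)
    h₁ h₂ hx hy hz (h.distInv_mem_first hu) (h.distInv_mem_first hv)
    (h.distInv_mem_second (mα _ hu)) (h.distInv_mem_second (mα _ hv))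
    (h.distInv_mem_third (mβ _ hu)) (h.distInv_mem_third (mβ _ hv)) pu pv
    (hlt _ _ _ hu _ hv (by linarith) rfl rfl)
  intro e
  have := h.strictMonoOn_distInv ⟨hu.1.le, by linarith [hu.2]⟩ ⟨hv.1.le, by linarith [hv.2]⟩
    (show δ / 3 < δ / 2 by linarith)
  exact this.ne (congrArg Prod.fst e)

lemma tendsto_distInv_third_add (h : IsPositiveRadial ρ s₁ s₂) :
    Tendsto (fun u => distInv ρ (1 / 3 + u)) (𝓝[>] 0) (𝓝 s₁) := by
  have h1 := (h.continuousAt_distInv (t := 1 / 3) (by norm_num)).tendsto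
  rw [h.distInv_third] at h1
  refine h1.comp (tendsto_nhdsWithin_of_tendsto_nhds ?_)
  exact (continuous_const.add continuous_id).tendsto' _ _ (by simp)

lemma tendsto_distInv_two_thirds_add (h : IsPositiveRadial ρ s₁ s₂) :
    Tendsto (fun u => distInv ρ (2 / 3 + u)) (𝓝[>] 0) (𝓝 s₂) := by
  have h1 := (h.continuousAt_distInv (t := 2 / 3) (by norm_num)).tendsto
  rw [h.distInv_two_thirds] at h1
  refine h1.comp (tendsto_nhdsWithin_of_tendsto_nhds ?_)
  exact (continuous_const.add continuous_id).tendsto' _ _ (by simp)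

lemma tendsto_distInv_two_thirds_sub (h : IsPositiveRadial ρ s₁ s₂) :
    Tendsto (fun u => distInv ρ (2 / 3 - u)) (𝓝[>] 0) (𝓝 s₂) := by
  have h1 := (h.continuousAt_distInv (t := 2 / 3) (by norm_num)).tendsto
  rw [h.distInv_two_thirds] at h1
  refine h1.comp (tendsto_nhdsWithin_of_tendsto_nhds ?_)
  exact (continuous_const.sub continuous_id).tendsto' _ _ (by simp)

lemma tendsto_distInv_one_sub (h : IsPositiveRadial ρ s₁ s₂) :
    Tendsto (fun u => distInv ρ (1 - u)) (𝓝[>] 0) atTop := by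
  refine h.tendsto_distInv_one.comp (tendsto_nhdsWithin_iff.2 ⟨?_, ?_⟩)
  · refine tendsto_nhdsWithin_of_tendsto_nhds ?_
    exact (continuous_const.sub continuous_id).tendsto' _ _ (by simp)
  · filter_upwards [self_mem_nhdsWithin] with u hu
    exact sub_lt_self (1 : ℝ) (mem_Ioi.1 hu)

/-- If `z = G (1 - u)` tends to infinity while `x = G u` tends to `0` and `y` stays in the second
third, the collinear configuration is eventually the cheapest. -/
lemma eventually_poly_pos (h : IsPositiveRadial ρ s₁ s₂) {α : ℝ → ℝ}
    (mα : ∀ u ∈ Ioo (0 : ℝ) (1 / 3), α u ∈ Ioo (1 / 3 : ℝ) (2 / 3)) :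
    ∀ᶠ u in 𝓝[>] (0 : ℝ),
      0 < poly (distInv ρ u) (distInv ρ (α u)) (distInv ρ (1 - u)) := by
  have hs := h.s₁_pos
  filter_upwards [Ioo_mem_nhdsGT (show (0 : ℝ) < 1 / 3 by norm_num),
    h.tendsto_distInv_one_sub.eventually_ge_atTop (2 * s₂),
    h.tendsto_distInv_zero.eventually (gt_mem_nhds (show 0 < s₁ / 38 by positivity))]
    with u hu hz hx
  obtain ⟨x0, xs⟩ := h.distInv_mem_first hu
  obtain ⟨y1, y2⟩ := h.distInv_mem_second (mα u hu)
  set x := distInv ρ u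
  set y := distInv ρ (α u)
  set z := distInv ρ (1 - u)
  have hy : 0 < y := hs.trans y1
  have hz0 : 0 < z := by linarith
  refine lt_of_lt_of_le ?_ (le_poly_of_small_first x0.le (xs.trans y1).le (by linarith))
  have e1 : 3 / 4 * z ^ 2 ≤ z ^ 2 - y ^ 2 := by nlinarith
  have e2 : s₁ * z * (3 / 4 * z ^ 2) ≤ y * z * (z ^ 2 - y ^ 2) := by gcongr
  have e3 : 19 * x * z ^ 3 < 19 * (s₁ / 38) * z ^ 3 := by gcongr
  have e4 : 0 < s₁ * z ^ 3 := by positivity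
  nlinarith

/-- The three coordinates increase together, so the terms in `x + y` and `y + z` are both improved
by exchanging the second coordinates. -/
lemma not_isOptimalPlan_II (h : IsPositiveRadial ρ s₁ s₂) (c : Letter) :
    ¬ IsOptimalPlan ρ (mongePlan ρ (letterMap ρ s₁ s₂ Letter.I Letter.I c)) := by
  have hs := h.s₁_pos
  have hs' := h.s₁_lt_s₂
  refine h.not_isOptimalPlan_of_branch (α := fun u => 1 / 3 + u) (β := fun u => 2 / 3 + u)
    (σ₁ := fun w => (w.1.1, w.2.2.1, w.1.2.2)) (σ₂ := fun w => (w.2.1, w.1.2.1, w.2.2.2))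
    (by fun_prop) (by fun_prop) (fun u hu => letterShift_I_first _ _ hu.2) (fun u hu => ?_)
    (by fun_prop) (by fun_prop) (Or.inl ⟨fun _ => rfl, fun _ => rfl⟩)
    (Or.inr ⟨fun _ => rfl, fun _ => rfl⟩) (Or.inl ⟨fun _ => rfl, fun _ => rfl⟩) ?_ ?_
  · rw [letterShift_I_second _ _ (by linarith [hu.1]) (by linarith [hu.2])]; ring
  · have hc : Continuous fun p : ℝ × ℝ × ℝ => poly p.1 p.2.1 p.2.2 := by unfold poly; fun_prop
    have ht := (hc.tendsto (0, s₁, s₂)).comp (h.tendsto_distInv_zero.prodMk_nhds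
      (h.tendsto_distInv_third_add.prodMk_nhds h.tendsto_distInv_two_thirds_add))
    refine ht.eventually (lt_mem_nhds ?_)
    have e : poly 0 s₁ s₂ = s₁ * s₂ * ((s₂ - s₁) * (s₂ + s₁)) := by rw [poly]; ring
    have := sub_pos.2 hs'
    have : 0 < s₂ := hs.trans hs'
    change 0 < poly 0 s₁ s₂
    rw [e]
    positivity
  · rintro P Q u hu v hv huv rfl rfl
    have mono := h.strictMonoOn_distInv
    have hX := mono ⟨hu.1.le, by linarith [hu.2]⟩ ⟨hv.1.le, by linarith [hv.2]⟩ huv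
    have hY := mono (a := 1 / 3 + u) (b := 1 / 3 + v) ⟨by linarith [hu.1], by linarith [hu.2]⟩
      ⟨by linarith [hv.1], by linarith [hv.2]⟩ (by linarith)
    have hZ := mono (a := 2 / 3 + u) (b := 2 / 3 + v) ⟨by linarith [hu.1], by linarith [hu.2]⟩
      ⟨by linarith [hv.1], by linarith [hv.2]⟩ (by linarith)
    have x1 := (h.distInv_mem_first hu).1
    have y1 := (h.distInv_mem_second (t := 1 / 3 + u) ⟨by linarith [hu.1], by linarith [hu.2]⟩).1
    have z1 := h.distInv_mem_third (t := 2 / 3 + u) ⟨by linarith [hu.1], by linarith [hu.2]⟩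
    have z1' : s₂ < distInv ρ (2 / 3 + u) := z1
    have c1 := cross_add_lt hX hY (by linarith)
    have c2 := cross_add_lt hY hZ (by linarith)
    simp only [collinearCost]
    linarith

/-- The second and the third coordinate decrease as the first increases, so the terms in `z - x` and
`y + z` are both improved by exchanging the third coordinates. -/
lemma not_isOptimalPlan_DI (h : IsPositiveRadial ρ s₁ s₂) (c : Letter) :
    ¬ IsOptimalPlan ρ (mongePlan ρ (letterMap ρ s₁ s₂ Letter.D Letter.I c)) := by
  have hs := h.s₁_pos
  have hs' := h.s₁_lt_s₂
  refine h.not_isOptimalPlan_of_branch (α := fun u => 2 / 3 - u) (β := fun u => 1 - u)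
    (σ₁ := fun w => (w.1.1, w.1.2.1, w.2.2.2)) (σ₂ := fun w => (w.2.1, w.2.2.1, w.1.2.2))
    (by fun_prop) (by fun_prop) (fun u hu => letterShift_D_first _ _ hu.2) (fun u hu => ?_)
    (by fun_prop) (by fun_prop) (Or.inl ⟨fun _ => rfl, fun _ => rfl⟩)
    (Or.inl ⟨fun _ => rfl, fun _ => rfl⟩) (Or.inr ⟨fun _ => rfl, fun _ => rfl⟩)
    (h.eventually_poly_pos fun u hu => ⟨by linarith [hu.2], by linarith [hu.1]⟩) ?_
  · rw [letterShift_I_second _ _ (by linarith [hu.2]) (by linarith [hu.1])]; ring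
  · rintro P Q u hu v hv huv rfl rfl
    have mono := h.strictMonoOn_distInv
    have hX := mono ⟨hu.1.le, by linarith [hu.2]⟩ ⟨hv.1.le, by linarith [hv.2]⟩ huv
    have hY := mono (a := 2 / 3 - v) (b := 2 / 3 - u) ⟨by linarith [hv.2], by linarith [hv.1]⟩
      ⟨by linarith [hu.2], by linarith [hu.1]⟩ (by linarith)
    have hZ := mono (a := 1 - v) (b := 1 - u) ⟨by linarith [hv.2], by linarith [hv.1]⟩
      ⟨by linarith [hu.2], by linarith [hu.1]⟩ (by linarith)
    have x2 := (h.distInv_mem_first hv).2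
    have y1 := (h.distInv_mem_second (t := 2 / 3 - v) ⟨by linarith [hv.2], by linarith [hv.1]⟩).1
    have z1' : s₂ < distInv ρ (1 - v) :=
      h.distInv_mem_third (t := 1 - v) ⟨by linarith [hv.2], by linarith [hv.1]⟩
    have c1 := cross_add_lt (neg_lt_neg hX) hZ (by linarith)
    have c2 := cross_add_lt hY hZ (by linarith)
    simp only [collinearCost, sub_eq_neg_add]
    simp only [sub_eq_neg_add] at c1 c2
    linarith

/-- The first two coordinates increase and the third decreases, so the terms in `x + y` and `z - x`
are both improved by exchanging the first coordinates. -/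
lemma not_isOptimalPlan_ID (h : IsPositiveRadial ρ s₁ s₂) (c : Letter) :
    ¬ IsOptimalPlan ρ (mongePlan ρ (letterMap ρ s₁ s₂ Letter.I Letter.D c)) := by
  have hs := h.s₁_pos
  have hs' := h.s₁_lt_s₂
  refine h.not_isOptimalPlan_of_branch (α := fun u => 1 / 3 + u) (β := fun u => 1 - u)
    (σ₁ := fun w => (w.2.1, w.1.2.1, w.1.2.2)) (σ₂ := fun w => (w.1.1, w.2.2.1, w.2.2.2))
    (by fun_prop) (by fun_prop) (fun u hu => letterShift_I_first _ _ hu.2) (fun u hu => ?_)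
    (by fun_prop) (by fun_prop) (Or.inr ⟨fun _ => rfl, fun _ => rfl⟩)
    (Or.inl ⟨fun _ => rfl, fun _ => rfl⟩) (Or.inl ⟨fun _ => rfl, fun _ => rfl⟩)
    (h.eventually_poly_pos fun u hu => ⟨by linarith [hu.1], by linarith [hu.2]⟩) ?_
  · rw [letterShift_D_second _ _ (by linarith [hu.1]) (by linarith [hu.2])]; ring
  · rintro P Q u hu v hv huv rfl rfl
    have mono := h.strictMonoOn_distInv
    have hX := mono ⟨hu.1.le, by linarith [hu.2]⟩ ⟨hv.1.le, by linarith [hv.2]⟩ huv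
    have hY := mono (a := 1 / 3 + u) (b := 1 / 3 + v) ⟨by linarith [hu.1], by linarith [hu.2]⟩
      ⟨by linarith [hv.1], by linarith [hv.2]⟩ (by linarith)
    have hZ := mono (a := 1 - v) (b := 1 - u) ⟨by linarith [hv.2], by linarith [hv.1]⟩
      ⟨by linarith [hu.2], by linarith [hu.1]⟩ (by linarith)
    have x1 := (h.distInv_mem_first hu).1
    have x2 := (h.distInv_mem_first hv).2
    have y1 := (h.distInv_mem_second (t := 1 / 3 + u) ⟨by linarith [hu.1], by linarith [hu.2]⟩).1
    have z1' : s₂ < distInv ρ (1 - v) :=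
      h.distInv_mem_third (t := 1 - v) ⟨by linarith [hv.2], by linarith [hv.1]⟩
    have c1 := cross_add_lt hX hY (by linarith)
    have c2 := cross_add_lt (neg_lt_neg hX) hZ (by linarith)
    simp only [collinearCost, sub_eq_neg_add]
    simp only [sub_eq_neg_add] at c1 c2
    linarith

end IsPositiveRadial

lemma obtuseDist_pos {a b : ℝ} (ha : 0 < a) (hb : 0 < b) : 0 < obtuseDist a b :=
  Real.sqrt_pos.2 (by positivity)

lemma tendsto_obtuseDist {ι : Type*} {l : Filter ι} {k k' : ι → ℝ} {a b : ℝ}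
    (hk : Tendsto k l (𝓝 a)) (hk' : Tendsto k' l (𝓝 b)) :
    Tendsto (fun w => obtuseDist (k w) (k' w)) l (𝓝 (obtuseDist a b)) := by
  unfold obtuseDist
  exact (((hk.pow 2).add (hk.mul hk')).add (hk'.pow 2)).sqrt

/-- The Coulomb cost of three points at angles of 120 degrees. -/
noncomputable def obtuseCost (x y z : ℝ) : ℝ :=
  1 / obtuseDist x y + 1 / obtuseDist x z + 1 / obtuseDist y z

lemma tendsto_obtuseCost {ι : Type*} {l : Filter ι} {k k' k'' : ι → ℝ} {a b c : ℝ}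
    (hk : Tendsto k l (𝓝 a)) (hk' : Tendsto k' l (𝓝 b)) (hk'' : Tendsto k'' l (𝓝 c))
    (ha : 0 < a) (hb : 0 < b) (hc : 0 < c) :
    Tendsto (fun w => obtuseCost (k w) (k' w) (k'' w)) l (𝓝 (obtuseCost a b c)) := by
  unfold obtuseCost
  exact ((tendsto_const_nhds.div (tendsto_obtuseDist hk hk') (obtuseDist_pos ha hb).ne').add
    (tendsto_const_nhds.div (tendsto_obtuseDist hk hk'') (obtuseDist_pos ha hc).ne')).add
    (tendsto_const_nhds.div (tendsto_obtuseDist hk' hk'') (obtuseDist_pos hb hc).ne')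

lemma continuousAt_obtuseCost {p : ℝ × ℝ × ℝ} (hx : 0 < p.1) (hy : 0 < p.2.1) (hz : 0 < p.2.2) :
    ContinuousAt (fun p : ℝ × ℝ × ℝ => obtuseCost p.1 p.2.1 p.2.2) p :=
  tendsto_obtuseCost continuousAt_fst (continuousAt_fst.comp continuousAt_snd)
    (continuousAt_snd.comp continuousAt_snd) hx hy hz

lemma obtuseCost_le {s x y z : ℝ} (hs : 0 < s) (hx : s ≤ x) (hy : s ≤ y) (hz : s ≤ z) :
    obtuseCost x y z ≤ √3 / s := by
  have h3 : √3 * √3 = 3 := Real.mul_self_sqrt (by norm_num)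
  have h0 : 0 < √3 := by positivity
  have e : √3 / s = 1 / (√3 * s) + 1 / (√3 * s) + 1 / (√3 * s) := by
    field_simp; linarith
  rw [e, obtuseCost]
  gcongr <;> exact sqrt_three_mul_le_obtuseDist hs.le ‹_› ‹_›

lemma eventually_radialCost_le_obtuseCost {p : ℝ × ℝ × ℝ} (hx : 0 < p.1) (hy : 0 < p.2.1)
    (hz : 0 < p.2.2) : ∀ᶠ q in 𝓝 p, radialCost q.1 q.2.1 q.2.2 ≤
      ENNReal.ofReal (obtuseCost q.1 q.2.1 q.2.2) := by
  have c₁ : ContinuousAt (fun p : ℝ × ℝ × ℝ => p.1) p := by fun_prop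
  have c₂ : ContinuousAt (fun p : ℝ × ℝ × ℝ => p.2.1) p := by fun_prop
  have c₃ : ContinuousAt (fun p : ℝ × ℝ × ℝ => p.2.2) p := by fun_prop
  filter_upwards [c₁.eventually (lt_mem_nhds hx), c₂.eventually (lt_mem_nhds hy),
    c₃.eventually (lt_mem_nhds hz)] with q h₁ h₂ h₃
  exact radialCost_le_obtuse h₁.le h₂.le h₃.le (obtuseDist_pos h₁ h₂) (obtuseDist_pos h₁ h₃)
    (obtuseDist_pos h₂ h₃)

/-- A lower bound for the radial cost, in which each distance is replaced by its largest possible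
value. -/
noncomputable def oppositeCost (x y z : ℝ) : ℝ := 1 / (x + y) + 1 / (x + z) + 1 / (y + z)

lemma oppositeCost_pos {x y z : ℝ} (hx : 0 < x) (hy : 0 < y) (hz : 0 < z) :
    0 < oppositeCost x y z := by
  unfold oppositeCost; positivity

lemma continuousAt_oppositeCost {p : ℝ × ℝ × ℝ} (hx : 0 < p.1) (hy : 0 < p.2.1)
    (hz : 0 < p.2.2) :
    ContinuousAt (fun p : ℝ × ℝ × ℝ => oppositeCost p.1 p.2.1 p.2.2) p := by
  unfold oppositeCost
  have c₁ : ContinuousAt (fun p : ℝ × ℝ × ℝ => p.1 + p.2.1) p := by fun_prop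
  have c₂ : ContinuousAt (fun p : ℝ × ℝ × ℝ => p.1 + p.2.2) p := by fun_prop
  have c₃ : ContinuousAt (fun p : ℝ × ℝ × ℝ => p.2.1 + p.2.2) p := by fun_prop
  exact ((continuousAt_const.div c₁ (add_pos hx hy).ne').add
    (continuousAt_const.div c₂ (add_pos hx hz).ne')).add
    (continuousAt_const.div c₃ (add_pos hy hz).ne')

/-- The swap between the limiting points `(0, s₂, s₂)` and `(s₁, s₁, ∞)` lowers the cost; the zeros
are the limits of the terms that involve the particle at infinity. -/
lemma limit_swap_lt {s₁ s₂ : ℝ} (hs : 0 < s₁) (hs' : s₁ < s₂)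
    (hratio : (1 + 2 * √3) / 5 < s₁ / s₂) :
    obtuseCost s₁ s₂ s₂ + (1 / (0 + s₁) + 0 + 0) <
      1 / (0 + s₂) + 1 / (0 + s₂) + 1 / (s₂ + s₂) + (1 / (s₁ + s₁) + 0 + 0) := by
  have hs₂ : 0 < s₂ := hs.trans hs'
  have h1 := obtuseCost_le hs le_rfl hs'.le hs'.le
  have h2 : √3 / s₁ + 1 / s₁ - 1 / (2 * s₁) < 5 / (2 * s₂) := by
    rw [div_lt_div_iff₀ (by norm_num) hs₂] at hratio
    rw [show √3 / s₁ + 1 / s₁ - 1 / (2 * s₁) = (1 + 2 * √3) / (2 * s₁) by field_simp; ring,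
      div_lt_div_iff₀ (by positivity) (by positivity)]
    linarith
  have h3 : 1 / (0 + s₂) + 1 / (0 + s₂) + 1 / (s₂ + s₂) = 5 / (2 * s₂) := by
    field_simp; ring
  have h4 : 1 / (s₁ + s₁) = 1 / (2 * s₁) := by rw [two_mul]
  rw [h3, h4]
  simp only [zero_add, add_zero]
  linarith

lemma tendsto_one_div_add {ι : Type*} {l : Filter ι} {k k' : ι → ℝ} {a b : ℝ}
    (hk : Tendsto k l (𝓝 a)) (hk' : Tendsto k' l (𝓝 b)) (hab : 0 < a + b) :
    Tendsto (fun w => 1 / (k w + k' w)) l (𝓝 (1 / (a + b))) :=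
  tendsto_const_nhds.div (hk.add hk') hab.ne'

lemma tendsto_one_div_add_atTop {ι : Type*} {l : Filter ι} {k k' : ι → ℝ} {a : ℝ}
    (hk : Tendsto k l (𝓝 a)) (hk' : Tendsto k' l atTop) :
    Tendsto (fun w => 1 / (k w + k' w)) l (𝓝 0) := by
  simpa [Function.comp_def] using tendsto_inv_atTop_zero.comp (hk.add_atTop hk')

/-- The limiting inequality holds for all points close enough to the two ends of the branch. -/
lemma eventually_swap_lt {ι : Type*} {l m : Filter ι} {X Y Z : ι → ℝ} {s₁ s₂ : ℝ}
    (hs : 0 < s₁) (hs' : s₁ < s₂) (hratio : (1 + 2 * √3) / 5 < s₁ / s₂)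
    (X0 : Tendsto X l (𝓝 0)) (Y0 : Tendsto Y l (𝓝 s₂)) (Z0 : Tendsto Z l (𝓝 s₂))
    (X1 : Tendsto X m (𝓝 s₁)) (Y1 : Tendsto Y m (𝓝 s₁)) (Z1 : Tendsto Z m atTop) :
    ∀ᶠ w in l ×ˢ m,
      obtuseCost (X w.2) (Y w.1) (Z w.1) + collinearCost (X w.1) (Y w.2) (Z w.2) <
      oppositeCost (X w.1) (Y w.1) (Z w.1) + oppositeCost (X w.2) (Y w.2) (Z w.2) := by
  have hs₂ : 0 < s₂ := hs.trans hs'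
  have f : Tendsto Prod.fst (l ×ˢ m) l := tendsto_fst
  have g : Tendsto Prod.snd (l ×ˢ m) m := tendsto_snd
  have x₀ : Tendsto (fun w : ι × ι => X w.1) (l ×ˢ m) (𝓝 0) := X0.comp f
  have y₀ : Tendsto (fun w : ι × ι => Y w.1) (l ×ˢ m) (𝓝 s₂) := Y0.comp f
  have z₀ : Tendsto (fun w : ι × ι => Z w.1) (l ×ˢ m) (𝓝 s₂) := Z0.comp f
  have x₁ : Tendsto (fun w : ι × ι => X w.2) (l ×ˢ m) (𝓝 s₁) := X1.comp g
  have y₁ : Tendsto (fun w : ι × ι => Y w.2) (l ×ˢ m) (𝓝 s₁) := Y1.comp g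
  have z₁ : Tendsto (fun w : ι × ι => Z w.2) (l ×ˢ m) atTop := Z1.comp g
  have t₁ : Tendsto (fun w : ι × ι => oppositeCost (X w.1) (Y w.1) (Z w.1)) (l ×ˢ m)
      (𝓝 (1 / (0 + s₂) + 1 / (0 + s₂) + 1 / (s₂ + s₂))) := by
    unfold oppositeCost
    exact ((tendsto_one_div_add x₀ y₀ (by linarith)).add
      (tendsto_one_div_add x₀ z₀ (by linarith))).add (tendsto_one_div_add y₀ z₀ (by linarith))
  have t₂ : Tendsto (fun w : ι × ι => oppositeCost (X w.2) (Y w.2) (Z w.2)) (l ×ˢ m)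
      (𝓝 (1 / (s₁ + s₁) + 0 + 0)) := by
    unfold oppositeCost
    exact ((tendsto_one_div_add x₁ y₁ (by linarith)).add
      (tendsto_one_div_add_atTop x₁ z₁)).add (tendsto_one_div_add_atTop y₁ z₁)
  have t₃ : Tendsto (fun w : ι × ι => obtuseCost (X w.2) (Y w.1) (Z w.1)) (l ×ˢ m)
      (𝓝 (obtuseCost s₁ s₂ s₂)) := tendsto_obtuseCost x₁ y₀ z₀ hs hs₂ hs₂
  have t₄ : Tendsto (fun w : ι × ι => collinearCost (X w.1) (Y w.2) (Z w.2)) (l ×ˢ m)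
      (𝓝 (1 / (0 + s₁) + 0 + 0)) := by
    unfold collinearCost
    have t := tendsto_one_div_add_atTop x₀.neg z₁
    simp only [← sub_eq_neg_add] at t
    exact ((tendsto_one_div_add x₀ y₁ (by linarith)).add t).add (tendsto_one_div_add_atTop y₁ z₁)
  exact (t₃.add t₄).eventually_lt (t₁.add t₂) (limit_swap_lt hs hs' hratio)

namespace IsPositiveRadial

variable {ρ : Measure ℝ} {s₁ s₂ : ℝ}

lemma exists_swap_lt (h : IsPositiveRadial ρ s₁ s₂) (hratio : (1 + 2 * √3) / 5 < s₁ / s₂) :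
    ∃ u ∈ Ioo (0 : ℝ) (1 / 6), ∃ w ∈ Ioo (1 / 6 : ℝ) (1 / 3),
      obtuseCost (distInv ρ w) (distInv ρ (2 / 3 - u)) (distInv ρ (2 / 3 + u)) +
        collinearCost (distInv ρ u) (distInv ρ (2 / 3 - w)) (distInv ρ (2 / 3 + w)) <
      oppositeCost (distInv ρ u) (distInv ρ (2 / 3 - u)) (distInv ρ (2 / 3 + u)) +
        oppositeCost (distInv ρ w) (distInv ρ (2 / 3 - w)) (distInv ρ (2 / 3 + w)) := by
  have hs := h.s₁_pos
  have ct : Tendsto (distInv ρ) (𝓝 (1 / 3)) (𝓝 s₁) := by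
    have := (h.continuousAt_distInv (t := 1 / 3) (by norm_num)).tendsto
    rwa [h.distInv_third] at this
  have X1 : Tendsto (distInv ρ) (𝓝[<] (1 / 3)) (𝓝 s₁) := tendsto_nhdsWithin_of_tendsto_nhds ct
  have Y1 : Tendsto (fun u => distInv ρ (2 / 3 - u)) (𝓝[<] (1 / 3)) (𝓝 s₁) := by
    refine tendsto_nhdsWithin_of_tendsto_nhds (ct.comp ?_)
    exact (continuous_const.sub continuous_id).tendsto' _ _ (by norm_num)
  have Z1 : Tendsto (fun u => distInv ρ (2 / 3 + u)) (𝓝[<] (1 / 3)) atTop := by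
    refine h.tendsto_distInv_one.comp (tendsto_nhdsWithin_iff.2 ⟨?_, ?_⟩)
    · refine tendsto_nhdsWithin_of_tendsto_nhds ?_
      exact (continuous_const.add continuous_id).tendsto' _ _ (by norm_num)
    · filter_upwards [self_mem_nhdsWithin] with u hu
      have : u < 1 / 3 := hu
      exact (by linarith : 2 / 3 + u < 1)
  obtain ⟨⟨u, w⟩, huw, hu, hw⟩ := ((eventually_swap_lt hs h.s₁_lt_s₂ hratio
    h.tendsto_distInv_zero h.tendsto_distInv_two_thirds_sub h.tendsto_distInv_two_thirds_add
    X1 Y1 Z1).and ((tendsto_fst.eventually (Ioo_mem_nhdsGT (show (0 : ℝ) < 1 / 6 by norm_num))).and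
      (tendsto_snd.eventually (Ioo_mem_nhdsLT (show (1 / 6 : ℝ) < 1 / 3 by norm_num))))).exists
  exact ⟨u, hu, w, hw, huw⟩

/-- The plan of a word `DD_` charges neighbourhoods of points close to `(0, s₂, s₂)` and to
`(s₁, s₁, ∞)`. Exchanging the first coordinates gives `(s₁, s₂, s₂)`, of cost at most `√3 / s₁`, and
`(0, s₁, ∞)`, of cost `1 / s₁`; the bound on `s₁ / s₂` says that this is less than the original
cost `5 / (2 s₂) + 1 / (2 s₁)`. -/
lemma not_isOptimalPlan_DD (h : IsPositiveRadial ρ s₁ s₂)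
    (hratio : (1 + 2 * √3) / 5 < s₁ / s₂) (c : Letter) :
    ¬ IsOptimalPlan ρ (mongePlan ρ (letterMap ρ s₁ s₂ Letter.D Letter.D c)) := by
  have := h.prob
  have hs := h.s₁_pos
  have hs' := h.s₁_lt_s₂
  have hs₂ : 0 < s₂ := hs.trans hs'
  have hα : ∀ u ∈ Ioo (0 : ℝ) (1 / 3), letterShift Letter.D Letter.D c u = 2 / 3 - u :=
    fun u hu => letterShift_D_first _ _ hu.2
  have hβ : ∀ u ∈ Ioo (0 : ℝ) (1 / 3), letterShift Letter.D Letter.D c (2 / 3 - u) = 2 / 3 + u :=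
    fun u hu => by
      rw [letterShift_D_second _ _ (by linarith [hu.2]) (by linarith [hu.1])]; ring
  obtain ⟨u, hu, w, hw, huw⟩ := h.exists_swap_lt hratio
  have mX : ∀ u ∈ Ioo (0 : ℝ) (1 / 3), distInv ρ u ∈ Ioo 0 s₁ := fun u hu => h.distInv_mem_first hu
  have mY : ∀ u ∈ Ioo (0 : ℝ) (1 / 3), distInv ρ (2 / 3 - u) ∈ Ioo s₁ s₂ := fun u hu =>
    h.distInv_mem_second ⟨by linarith [hu.2], by linarith [hu.1]⟩
  have mZ : ∀ u ∈ Ioo (0 : ℝ) (1 / 3), s₂ < distInv ρ (2 / 3 + u) := fun u hu =>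
    h.distInv_mem_third (t := 2 / 3 + u) ⟨by linarith [hu.1], by linarith [hu.2]⟩
  have hu' : u ∈ Ioo (0 : ℝ) (1 / 3) := ⟨hu.1, hu.2.trans (by norm_num)⟩
  have hw' : w ∈ Ioo (0 : ℝ) (1 / 3) := ⟨lt_trans (by norm_num) hw.1, hw.2⟩
  have xu := (mX u hu').1
  have xw := (mX w hw').1
  have yu := hs.trans (mY u hu').1
  have yw := hs.trans (mY w hw').1
  have zu := hs₂.trans (mZ u hu')
  have zw := hs₂.trans (mZ w hw')
  have xz : distInv ρ u < distInv ρ (2 / 3 + w) := (mX u hu').2.trans (hs'.trans (mZ w hw'))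
  refine not_isOptimalPlan_of_swap (h.mongePlan_mem_couplings Letter.D Letter.D c)
    (h.planCost_mongePlan_ne_top Letter.D Letter.D c)
    (P := (distInv ρ u, distInv ρ (2 / 3 - u), distInv ρ (2 / 3 + u)))
    (Q := (distInv ρ w, distInv ρ (2 / 3 - w), distInv ρ (2 / 3 + w))) ?_
    (h.mongePlan_pos_of_mem_nhds (α := fun u => 2 / 3 - u) (β := fun u => 2 / 3 + u)
      (by fun_prop) (by fun_prop) hα hβ hu')
    (h.mongePlan_pos_of_mem_nhds (α := fun u => 2 / 3 - u) (β := fun u => 2 / 3 + u)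
      (by fun_prop) (by fun_prop) hα hβ hw')
    (σ₁ := fun w => (w.2.1, w.1.2.1, w.1.2.2)) (σ₂ := fun w => (w.1.1, w.2.2.1, w.2.2.2))
    (by fun_prop) (by fun_prop) (Or.inr ⟨fun _ => rfl, fun _ => rfl⟩)
    (Or.inl ⟨fun _ => rfl, fun _ => rfl⟩) (Or.inl ⟨fun _ => rfl, fun _ => rfl⟩)
    (continuousAt_oppositeCost xu yu zu) (continuousAt_oppositeCost xw yw zw)
    (continuousAt_obtuseCost xw yu zu)
    (continuousAt_collinearCost (add_pos xu yw) (sub_pos.2 xz) (add_pos yw zw))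
    (Eventually.of_forall fun p => ofReal_sum_le_radialCost _ _ _)
    (Eventually.of_forall fun p => ofReal_sum_le_radialCost _ _ _)
    (eventually_radialCost_le_obtuseCost xw yu zu)
    (eventually_radialCost_le_collinearCost xu yw xz)
    (oppositeCost_pos xu yu zu) (oppositeCost_pos xw yw zw) ?_
    (collinearCost_pos xu yw xz).le huw
  · intro e
    have := h.strictMonoOn_distInv ⟨hu.1.le, by linarith [hu.2]⟩
      ⟨by linarith [hw.1], by linarith [hw.2]⟩ (hu.2.trans hw.1)
    exact this.ne (congrArg Prod.fst e)
  · have h1 := obtuseDist_pos xw yu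
    have h2 := obtuseDist_pos xw zu
    have h3 := obtuseDist_pos yu zu
    change 0 ≤ obtuseCost (distInv ρ w) (distInv ρ (2 / 3 - u)) (distInv ρ (2 / 3 + u))
    unfold obtuseCost
    positivity

theorem noOptimalInClass (h : IsPositiveRadial ρ s₁ s₂)
    (hratio : (1 + 2 * √3) / 5 < s₁ / s₂) : NoOptimalInClass ρ s₁ s₂ := by
  rintro S ⟨a, b, c, rfl⟩
  refine ⟨h.mongePlan_mem_couplings a b c, ?_⟩
  cases a <;> cases b
  · exact h.not_isOptimalPlan_II c
  · exact h.not_isOptimalPlan_ID c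
  · exact h.not_isOptimalPlan_DI c
  · exact h.not_isOptimalPlan_DD hratio c

end IsPositiveRadial

/-! ### A smooth example: the quantile function -/

/-- The summand of the quantile function with the pole at `1`. The normalization gives it the
value `1 / 20` at `2 / 3`; the high power makes it negligible on the first third and large compared
with `1 / (1 - u)` beyond `5 / 6`. -/
noncomputable def tailPart (u : ℝ) : ℝ := (3 * u / 2) ^ 55 / (60 * (1 - u))

/-- The quantile function (the inverse of the distribution function) of the example, on `u < 1`: a
small linear term, a smooth step from `0` to `1` between `1 / 6` and `1 / 4`, and a pole. -/
noncomputable def quantile (u : ℝ) : ℝ :=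
  u / 200 + Real.smoothTransition (12 * u - 2) + tailPart u

lemma tailPart_nonneg {u : ℝ} (h₀ : 0 ≤ u) (h₁ : u < 1) : 0 ≤ tailPart u := by
  have := sub_pos.2 h₁
  unfold tailPart
  positivity

lemma tailPart_mono {u v : ℝ} (h₀ : 0 ≤ u) (huv : u ≤ v) (h₁ : v < 1) :
    tailPart u ≤ tailPart v := by
  have := sub_pos.2 h₁
  have hv := h₀.trans huv
  unfold tailPart
  gcongr

lemma quantile_zero : quantile 0 = 0 := by
  rw [quantile, tailPart, Real.smoothTransition.zero_of_nonpos (by norm_num)]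
  norm_num

lemma le_quantile_sub {u v : ℝ} (h₀ : 0 ≤ u) (huv : u ≤ v) (h₁ : v < 1) :
    (v - u) / 200 ≤ quantile v - quantile u := by
  have h2 := tailPart_mono h₀ huv h₁
  have h3 : Real.smoothTransition (12 * u - 2) ≤ Real.smoothTransition (12 * v - 2) :=
    Real.smoothTransition.monotone (by linarith)
  unfold quantile
  linarith

lemma quantile_of_quarter_le {u : ℝ} (h : 1 / 4 ≤ u) : quantile u = u / 200 + 1 + tailPart u := by
  rw [quantile, Real.smoothTransition.one_of_one_le (by linarith)]

lemma quantile_two_thirds : quantile (2 / 3) = 79 / 75 := by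
  rw [quantile_of_quarter_le (by norm_num), tailPart]
  norm_num

lemma tailPart_two_thirds_add (u : ℝ) :
    tailPart (2 / 3 + u) = (1 + 3 * u / 2) ^ 55 / (20 * (1 - 3 * u)) := by
  rw [tailPart, show 3 * (2 / 3 + u) / 2 = 1 + 3 * u / 2 by ring,
    show 60 * (1 - (2 / 3 + u)) = 20 * (1 - 3 * u) by ring]

lemma quantile_le_of_le_sixth {u : ℝ} (h₀ : 0 ≤ u) (h₁ : u ≤ 1 / 6) : quantile u ≤ u / 190 := by
  have h2 : (3 * u / 2) ^ 55 ≤ (3 * u / 2) * (1 / 4) ^ 54 := by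
    rw [pow_succ' _ 54]
    exact mul_le_mul_of_nonneg_left (pow_le_pow_left₀ (by linarith) (by linarith) 54) (by linarith)
  have h3 : tailPart u ≤ (3 * u / 2) * (1 / 4) ^ 54 / (60 * (1 - 1 / 6)) := by
    unfold tailPart
    gcongr
  rw [quantile, Real.smoothTransition.zero_of_nonpos (by linarith)]
  have h4 : (3 * u / 2) * (1 / 4) ^ 54 / (60 * (1 - 1 / 6)) ≤ u / 10000 := by
    rw [show (3 * u / 2) * (1 / 4) ^ 54 / (60 * (1 - 1 / 6)) =
      u * (3 / 2 * (1 / 4) ^ 54 / (60 * (1 - 1 / 6))) by ring, div_eq_mul_inv]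
    exact mul_le_mul_of_nonneg_left (by norm_num) h₀
  linarith

/-- The polynomial condition for the quantile function. For `u ≤ 1 / 6` the first point is small
compared with the distance between the other two; for `u > 1 / 6` the third point is so far away
that its product with the distance between the first two is large. -/
lemma poly_quantile_nonneg {u : ℝ} (h₀ : 0 < u) (h₁ : u < 1 / 3) :
    0 ≤ poly (quantile u) (quantile (2 / 3 - u)) (quantile (2 / 3 + u)) := by
  have hx0 : 0 ≤ quantile u := by
    have := le_quantile_sub le_rfl h₀.le (by linarith)
    rw [quantile_zero] at this
    linarith
  have hxy := le_quantile_sub h₀.le (show u ≤ 2 / 3 - u by linarith) (by linarith)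
  have hys := le_quantile_sub (show 0 ≤ 2 / 3 - u by linarith) (show 2 / 3 - u ≤ 2 / 3 by linarith)
    (by norm_num)
  have hy1 : 1 ≤ quantile (2 / 3 - u) := by
    rw [quantile_of_quarter_le (by linarith)]
    have := tailPart_nonneg (show 0 ≤ 2 / 3 - u by linarith) (by linarith)
    linarith
  have hz : quantile (2 / 3 + u) = (2 / 3 + u) / 200 + 1 +
      (1 + 3 * u / 2) ^ 55 / (20 * (1 - 3 * u)) := by
    rw [quantile_of_quarter_le (by linarith), tailPart_two_thirds_add]
  rw [quantile_two_thirds] at hys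
  have h3 : 0 < 1 - 3 * u := by linarith
  have hJ : (1 + 3 * u) / 20 ≤ (1 + 3 * u / 2) ^ 55 / (20 * (1 - 3 * u)) := by
    rw [div_le_div_iff₀ (by norm_num) (by positivity)]
    have : 1 ≤ (1 + 3 * u / 2) ^ 55 := one_le_pow₀ (by linarith)
    nlinarith
  have hlarge : 1 / 6 ≤ u → 35 ≤ (2 / 3 - u - u) / 200 * quantile (2 / 3 + u) := by
    intro h6
    have e : (2 / 3 - u - u) / 200 * ((5 / 4) ^ 55 / (20 * (1 - 3 * u))) =
        (5 / 4) ^ 55 / 6000 := by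
      field_simp; ring
    have h5 : (5 / 4 : ℝ) ^ 55 ≤ (1 + 3 * u / 2) ^ 55 := by gcongr; linarith
    calc (35 : ℝ) ≤ (5 / 4) ^ 55 / 6000 := by norm_num
      _ = (2 / 3 - u - u) / 200 * ((5 / 4) ^ 55 / (20 * (1 - 3 * u))) := e.symm
      _ ≤ (2 / 3 - u - u) / 200 * quantile (2 / 3 + u) := by
        have : (0 : ℝ) ≤ (2 / 3 - u - u) / 200 := by linarith
        gcongr
        rw [hz]
        refine (div_le_div_of_nonneg_right h5 (by positivity)).trans ?_
        linarith
  have hx6 : u ≤ 1 / 6 → quantile u ≤ u / 190 := quantile_le_of_le_sixth h₀.le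
  have hzy : 3 * u / 20 ≤ quantile (2 / 3 + u) - quantile (2 / 3 - u) := by
    rw [hz]; linarith
  clear hz hJ
  generalize quantile u = x at *
  generalize quantile (2 / 3 - u) = y at *
  generalize quantile (2 / 3 + u) = z at *
  have hxy' : x ≤ y := by linarith
  have hyz' : y ≤ z := by linarith
  have hz0 : 0 < z := by linarith
  rcases le_total u (1 / 6) with h6 | h6
  · refine le_trans ?_ (le_poly_of_small_first hx0 hxy' hyz')
    have hx := hx6 h6
    have k : 19 * x * z ≤ y * (z - y) := by
      have k1 : 19 * x * z ≤ 19 * (u / 190) * z := by gcongr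
      nlinarith [mul_le_mul_of_nonneg_right hzy (show 0 ≤ y - 1 / 60 by linarith)]
    have k2 : 19 * x * z * z ^ 2 ≤ y * (z - y) * z ^ 2 := by gcongr
    have k3 : 0 ≤ y * z * y * (z - y) :=
      mul_nonneg (by positivity) (by linarith)
    nlinarith
  · refine le_trans ?_ (le_poly_of_large_third hx0 hxy' hyz')
    have k1 : (2 / 3 - u - u) / 200 * z ≤ (y - x) * z := by gcongr
    have k2 : 19 * y ^ 2 ≤ 35 := by nlinarith
    have := hlarge h6
    exact mul_nonneg (by positivity) (by linarith)

lemma ratio_quantile : (1 + 2 * √3) / 5 < quantile (1 / 3) / quantile (2 / 3) := by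
  have h1 : 1 ≤ quantile (1 / 3) := by
    rw [quantile_of_quarter_le (by norm_num)]
    have := tailPart_nonneg (u := 1 / 3) (by norm_num) (by norm_num)
    linarith
  have h2 : √3 < 1.74 := by
    rw [Real.sqrt_lt' (by norm_num)]; norm_num
  rw [quantile_two_thirds, div_lt_div_iff₀ (by norm_num) (by norm_num)]
  linarith

/-! ### A smooth example: the density -/

/-- The derivative of the quantile function. -/
noncomputable def quantileDeriv (u : ℝ) : ℝ :=
  1 / 200 + deriv Real.smoothTransition (12 * u - 2) * 12 +
    (55 * (3 * u / 2) ^ 54 * (3 / 2) * (60 * (1 - u)) - (3 * u / 2) ^ 55 * (60 * (-1))) /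
      (60 * (1 - u)) ^ 2

lemma hasDerivAt_quantile {u : ℝ} (hu : u < 1) : HasDerivAt quantile (quantileDeriv u) u := by
  have h1 : HasDerivAt (fun u : ℝ => u / 200) (1 / 200) u := (hasDerivAt_id u).div_const 200
  have h2 : HasDerivAt (fun u : ℝ => 12 * u - 2) 12 u := by
    simpa using ((hasDerivAt_id u).const_mul 12).sub_const 2
  have h3 : HasDerivAt Real.smoothTransition (deriv Real.smoothTransition (12 * u - 2))
      (12 * u - 2) :=
    ((Real.smoothTransition.contDiff (n := 1)).differentiable (by norm_num) _).hasDerivAt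
  have h4 : HasDerivAt (fun u : ℝ => 3 * u / 2) (3 / 2) u := by
    simpa using ((hasDerivAt_id u).const_mul 3).div_const 2
  have h5 : HasDerivAt (fun u : ℝ => 60 * (1 - u)) (60 * (-1)) u :=
    ((hasDerivAt_id u).const_sub 1).const_mul 60
  have h6 := (h4.pow 55).div h5 (by linarith)
  exact (h1.add (h3.comp u h2)).add h6

lemma quantileDeriv_pos {u : ℝ} (hu : u < 1) : 0 < quantileDeriv u := by
  have h1 : 0 ≤ deriv Real.smoothTransition (12 * u - 2) :=
    Real.smoothTransition.monotone.deriv_nonneg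
  have e : 55 * (3 * u / 2) ^ 54 * (3 / 2) * (60 * (1 - u)) - (3 * u / 2) ^ 55 * (60 * (-1)) =
      (3 * u / 2) ^ 54 * (90 * (55 * (1 - u) + u)) := by
    rw [pow_succ (3 * u / 2) 54]
    generalize (3 * u / 2) ^ 54 = p
    ring
  have h2 : 0 ≤ (3 * u / 2) ^ 54 := Even.pow_nonneg (by decide) _
  have h3 : 0 ≤ 55 * (1 - u) + u := by linarith
  rw [quantileDeriv, e]
  exact add_pos_of_pos_of_nonneg (add_pos_of_pos_of_nonneg (by norm_num)
    (mul_nonneg h1 (by norm_num))) (div_nonneg (mul_nonneg h2 (by linarith)) (sq_nonneg _))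

lemma strictMonoOn_quantile : StrictMonoOn quantile (Iio 1) := by
  refine strictMonoOn_of_deriv_pos (convex_Iio 1)
    (fun u hu => (hasDerivAt_quantile hu).continuousAt.continuousWithinAt) fun u hu => ?_
  rw [interior_Iio] at hu
  rw [(hasDerivAt_quantile hu).deriv]
  exact quantileDeriv_pos hu

lemma contDiffAt_quantile {u : ℝ} (hu : u < 1) : ContDiffAt ℝ ∞ quantile u := by
  have h1 : ContDiffAt ℝ ∞ (fun u : ℝ => (3 * u / 2) ^ 55 / (60 * (1 - u))) u :=
    ContDiffAt.div (by fun_prop) (by fun_prop) (by linarith)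
  have h2 : ContDiffAt ℝ ∞ (fun u : ℝ => Real.smoothTransition (12 * u - 2)) u :=
    (Real.smoothTransition.contDiff (n := ⊤)).contDiffAt.comp u (by fun_prop)
  exact ((contDiffAt_id.div_const 200).add h2).add h1

lemma exists_quantile_eq {x : ℝ} (hx : 0 ≤ x) : ∃ u, 0 ≤ u ∧ u < 1 ∧ quantile u = x := by
  set t : ℝ := 1 - 1 / (60 * (x + 1)) with ht
  have h1 : 1 / (60 * (x + 1)) ≤ 1 / 60 := by
    gcongr; linarith
  have h2 : 0 < 1 / (60 * (x + 1)) := by positivity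
  have h3 : x ≤ quantile t := by
    rw [quantile_of_quarter_le (by linarith)]
    have h4 : 1 ≤ (3 * t / 2) ^ 55 := one_le_pow₀ (by linarith)
    have h5 : x + 1 ≤ tailPart t := by
      rw [tailPart, ht, sub_sub_cancel, ← ht, le_div_iff₀ (by positivity)]
      have : (x + 1) * (60 * (1 / (60 * (x + 1)))) = 1 := by field_simp
      rw [this]; exact h4
    linarith
  obtain ⟨u, hu, rfl⟩ := intermediate_value_Icc (show 0 ≤ t by linarith)
    (fun u hu =>
      (hasDerivAt_quantile (show u < 1 by linarith [hu.2])).continuousAt.continuousWithinAt)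
    (show x ∈ Icc (quantile 0) (quantile t) from ⟨by rwa [quantile_zero], h3⟩)
  exact ⟨u, hu.1, by linarith [hu.2], rfl⟩

/-- The inverse of the quantile function. -/
noncomputable def quantileInv : ℝ → ℝ := Function.invFunOn quantile (Iio 1)

lemma quantileInv_quantile {u : ℝ} (hu : u < 1) : quantileInv (quantile u) = u :=
  strictMonoOn_quantile.injOn.leftInvOn_invFunOn hu

lemma eventually_quantileInv_quantile {u : ℝ} (hu : u < 1) :
    ∀ᶠ v in 𝓝 u, quantileInv (quantile v) = v :=
  (gt_mem_nhds hu).mono fun _ hv => quantileInv_quantile hv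

lemma contDiffAt_quantileInv {u : ℝ} (hu : u < 1) : ContDiffAt ℝ ∞ quantileInv (quantile u) := by
  have hf := contDiffAt_quantile hu
  have hf' := (hasDerivAt_quantile hu).hasFDerivAt_equiv (quantileDeriv_pos hu).ne'
  refine (hf.to_localInverse hf' (by simp)).congr_of_eventuallyEq ?_
  exact (hf.hasStrictFDerivAt' hf' (by simp)).localInverse_unique
    (eventually_quantileInv_quantile hu)

/-- The density of the example: the derivative of its distribution function. -/
noncomputable def exampleDensity : ℝ → ℝ := deriv quantileInv

lemma contDiffOn_exampleDensity : ContDiffOn ℝ ∞ exampleDensity (Ici 0) := by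
  intro x hx
  obtain ⟨u, -, hu, rfl⟩ := exists_quantile_eq hx
  exact ((contDiffAt_quantileInv hu).derivWithin (m := ∞) (by simp)).contDiffWithinAt

lemma hasDerivAt_quantileInv {x : ℝ} (hx : 0 ≤ x) :
    HasDerivAt quantileInv (exampleDensity x) x := by
  obtain ⟨u, -, hu, rfl⟩ := exists_quantile_eq hx
  exact ((contDiffAt_quantileInv hu).differentiableAt (by simp)).hasDerivAt

lemma exampleDensity_pos {x : ℝ} (hx : 0 ≤ x) : 0 < exampleDensity x := by
  obtain ⟨u, -, hu, rfl⟩ := exists_quantile_eq hx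
  have h1 := (hasDerivAt_quantileInv hx).comp u (hasDerivAt_quantile hu)
  have h2 : HasDerivAt (quantileInv ∘ quantile) 1 u :=
    (hasDerivAt_id u).congr_of_eventuallyEq (eventually_quantileInv_quantile hu)
  have h3 := h1.unique h2
  exact pos_of_mul_pos_left (h3 ▸ one_pos) (quantileDeriv_pos hu).le

lemma tendsto_quantileInv : Tendsto quantileInv atTop (𝓝 1) := by
  refine tendsto_order.2 ⟨fun t ht => ?_, fun t ht => ?_⟩
  · filter_upwards [eventually_gt_atTop (quantile t), eventually_ge_atTop 0] with x hx hx0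
    obtain ⟨u, -, hu, rfl⟩ := exists_quantile_eq hx0
    rw [quantileInv_quantile hu]
    exact (strictMonoOn_quantile.lt_iff_lt ht hu).1 hx
  · filter_upwards [eventually_ge_atTop 0] with x hx0
    obtain ⟨u, -, hu, rfl⟩ := exists_quantile_eq hx0
    rw [quantileInv_quantile hu]
    exact hu.trans ht

lemma densityMeasure_Ici {a : ℝ} (ha : 0 ≤ a) :
    densityMeasure exampleDensity (Ici a) = ENNReal.ofReal (1 - quantileInv a) := by
  have hd : ∀ x ∈ Ici a, HasDerivAt quantileInv (exampleDensity x) x := fun x hx =>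
    hasDerivAt_quantileInv (ha.trans hx)
  have hpos : ∀ x ∈ Ioi a, 0 ≤ exampleDensity x := fun x hx =>
    (exampleDensity_pos (ha.trans (mem_Ioi.1 hx).le)).le
  rw [densityMeasure, withDensity_apply _ measurableSet_Ici, Measure.restrict_restrict
    measurableSet_Ici, inter_eq_left.2 (Ici_subset_Ici.2 ha), ← restrict_Ioi_eq_restrict_Ici,
    ← ofReal_integral_eq_lintegral_ofReal (integrableOn_Ioi_deriv_of_nonneg' hd hpos
      tendsto_quantileInv) ((ae_restrict_iff' measurableSet_Ioi).2 (Eventually.of_forall hpos)),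
    integral_Ioi_of_hasDerivAt_of_nonneg' hd hpos tendsto_quantileInv]

lemma quantileInv_lt_one {x : ℝ} (hx : 0 ≤ x) : quantileInv x < 1 := by
  obtain ⟨u, -, hu, rfl⟩ := exists_quantile_eq hx
  rwa [quantileInv_quantile hu]

lemma quantileInv_lt {a b : ℝ} (ha : 0 ≤ a) (hab : a < b) : quantileInv a < quantileInv b := by
  obtain ⟨u, -, hu, rfl⟩ := exists_quantile_eq ha
  obtain ⟨v, -, hv, rfl⟩ := exists_quantile_eq (ha.trans hab.le)
  rw [quantileInv_quantile hu, quantileInv_quantile hv]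
  exact (strictMonoOn_quantile.lt_iff_lt hu hv).1 hab

lemma densityMeasure_Ico {a b : ℝ} (ha : 0 ≤ a) (hab : a ≤ b) :
    densityMeasure exampleDensity (Ico a b) =
      ENNReal.ofReal (quantileInv b - quantileInv a) := by
  have h1 := measure_union (μ := densityMeasure exampleDensity)
    (Set.disjoint_left.2 fun x hx hx' => absurd hx.2 (not_lt.2 hx') :
      Disjoint (Ico a b) (Ici b)) measurableSet_Ici
  rw [Ico_union_Ici_eq_Ici hab, densityMeasure_Ici ha, densityMeasure_Ici (ha.trans hab)] at h1
  have h2 : quantileInv a ≤ quantileInv b := by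
    rcases hab.eq_or_lt with rfl | h
    · exact le_rfl
    · exact (quantileInv_lt ha h).le
  rw [show 1 - quantileInv a = (quantileInv b - quantileInv a) + (1 - quantileInv b) by ring,
    ENNReal.ofReal_add (sub_nonneg.2 h2)
      (sub_nonneg.2 (quantileInv_lt_one (ha.trans hab)).le)] at h1
  exact ((ENNReal.add_left_inj ENNReal.ofReal_ne_top).1 h1).symm

lemma quantileInv_zero : quantileInv 0 = 0 := by
  rw [← quantile_zero, quantileInv_quantile one_pos, quantile_zero]

lemma ofReal_one_third : ENNReal.ofReal (1 / 3) = 1 / 3 := by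
  rw [ENNReal.ofReal_div_of_pos (by norm_num)]
  simp

lemma quantile_nonneg {u : ℝ} (h₀ : 0 ≤ u) (h₁ : u < 1) : 0 ≤ quantile u := by
  rw [← quantile_zero]
  exact strictMonoOn_quantile.monotoneOn (mem_Iio.2 one_pos) h₁ h₀

lemma isPositiveRadial_example :
    IsPositiveRadial (densityMeasure exampleDensity) (quantile (1 / 3)) (quantile (2 / 3)) := by
  have hac : densityMeasure exampleDensity ≪ volume :=
    (withDensity_absolutelyContinuous _ _).trans Measure.absolutelyContinuous_restrict
  have hneg : densityMeasure exampleDensity (Iio 0) = 0 := by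
    refine withDensity_absolutelyContinuous _ _ ?_
    rw [Measure.restrict_apply measurableSet_Iio, show Iio (0 : ℝ) ∩ Ici 0 = ∅ from
      Set.disjoint_iff_inter_eq_empty.1 (Set.disjoint_left.2 fun x hx hx' =>
        absurd (mem_Iio.1 hx) (not_lt.2 hx')), measure_empty]
  have hatom : ∀ x : ℝ, densityMeasure exampleDensity {x} = 0 := fun x =>
    hac (measure_singleton x)
  have hm : quantile (1 / 3) < quantile (2 / 3) :=
    strictMonoOn_quantile (by norm_num) (by norm_num) (by norm_num)
  have i₁ : quantileInv (quantile (1 / 3)) = 1 / 3 := quantileInv_quantile (by norm_num)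
  have i₂ : quantileInv (quantile (2 / 3)) = 2 / 3 := quantileInv_quantile (by norm_num)
  have p₁ : 0 ≤ quantile (1 / 3) := quantile_nonneg (by norm_num) (by norm_num)
  refine ⟨⟨?_⟩, hatom, hneg, fun a b ha hab => ?_, ?_, ?_, ?_⟩
  · have hd : Disjoint (Iio (0 : ℝ)) (Ici 0) := Set.disjoint_left.2 fun x hx hx' =>
      absurd (mem_Iio.1 hx) (not_lt.2 hx')
    rw [← Iio_union_Ici (a := (0 : ℝ)), measure_union hd measurableSet_Ici, hneg,
      densityMeasure_Ici le_rfl,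
      quantileInv_zero]
    simp
  · rw [measure_congr (hac.ae_le Ioo_ae_eq_Ico), densityMeasure_Ico ha hab.le]
    exact ENNReal.ofReal_pos.2 (sub_pos.2 (quantileInv_lt ha hab))
  · rw [densityMeasure_Ico le_rfl p₁, i₁, quantileInv_zero, sub_zero, ofReal_one_third]
  · rw [densityMeasure_Ico p₁ hm.le, i₁, i₂, ← ofReal_one_third]
    norm_num
  · rw [densityMeasure_Ici (p₁.trans hm.le), i₂, ← ofReal_one_third]
    norm_num

lemma distInv_example {u : ℝ} (h₀ : 0 ≤ u) (h₁ : u < 1) :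
    distInv (densityMeasure exampleDensity) u = quantile u := by
  have hq := quantile_nonneg h₀ h₁
  have e : distFun (densityMeasure exampleDensity) (quantile u) = u := by
    rw [distFun, Measure.real, densityMeasure_Ico le_rfl hq, quantileInv_quantile h₁,
      quantileInv_zero, sub_zero, ENNReal.toReal_ofReal h₀]
  conv_lhs => rw [← e]
  exact isPositiveRadial_example.distInv_distFun hq

lemma polyOnDDI_example :
    PolyOnDDI (densityMeasure exampleDensity) (quantile (1 / 3)) (quantile (2 / 3)) := by
  refine Eventually.of_forall fun x hx => ?_
  have h := isPositiveRadial_example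
  obtain ⟨u, hu0, hu1, rfl⟩ := exists_quantile_eq hx.1.le
  have hu3 : u < 1 / 3 := (strictMonoOn_quantile.lt_iff_lt hu1 (by norm_num)).1 hx.2
  have hu : 0 < u := by
    refine lt_of_le_of_ne hu0 fun e => hx.1.ne ?_
    rw [← e, quantile_zero]
  have e₁ : ddiMap (densityMeasure exampleDensity) (quantile (1 / 3)) (quantile (2 / 3))
      (quantile u) = quantile (2 / 3 - u) := by
    rw [ddiMap, ← distInv_example hu0 hu1, h.letterMap_distInv _ _ _ ⟨hu0, hu1⟩,
      letterShift_D_first _ _ hu3, distInv_example (by linarith) (by linarith)]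
  have e₂ : ddiMap (densityMeasure exampleDensity) (quantile (1 / 3)) (quantile (2 / 3))
      (quantile (2 / 3 - u)) = quantile (2 / 3 + u) := by
    rw [ddiMap, ← distInv_example (u := 2 / 3 - u) (by linarith) (by linarith),
      h.letterMap_distInv _ _ _ ⟨by linarith, by linarith⟩,
      letterShift_D_second _ _ (by linarith) (by linarith),
      show 4 / 3 - (2 / 3 - u) = 2 / 3 + u by ring, distInv_example (by linarith) (by linarith)]
  rw [e₁, e₂]
  exact poly_quantile_nonneg hu hu3

end RadialCoulomb

theorem mainTheorem3 :
    (∀ (ρ : MeasureTheory.Measure ℝ) (s₁ s₂ : ℝ),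
      RadialCoulomb.IsPositiveRadial ρ s₁ s₂ →
      (1 + 2 * Real.sqrt 3) / 5 < s₁ / s₂ →
      RadialCoulomb.PolyOnDDI ρ s₁ s₂ →
      RadialCoulomb.NoOptimalInClass ρ s₁ s₂) ∧
    (∃ (f : ℝ → ℝ) (s₁ s₂ : ℝ),
      ContDiffOn ℝ ∞ f (Set.Ici 0) ∧
      (∀ x : ℝ, 0 ≤ x → 0 < f x) ∧
      RadialCoulomb.IsPositiveRadial (RadialCoulomb.densityMeasure f) s₁ s₂ ∧
      (1 + 2 * Real.sqrt 3) / 5 < s₁ / s₂ ∧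
      RadialCoulomb.PolyOnDDI (RadialCoulomb.densityMeasure f) s₁ s₂ ∧
      RadialCoulomb.NoOptimalInClass (RadialCoulomb.densityMeasure f) s₁ s₂) :=
  ⟨fun _ _ _ h hratio _ => h.noOptimalInClass hratio,
    RadialCoulomb.exampleDensity, RadialCoulomb.quantile (1 / 3), RadialCoulomb.quantile (2 / 3),
    RadialCoulomb.contDiffOn_exampleDensity, fun _ hx => RadialCoulomb.exampleDensity_pos hx,
    RadialCoulomb.isPositiveRadial_example, RadialCoulomb.ratio_quantile,
    RadialCoulomb.polyOnDDI_example,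
    RadialCoulomb.isPositiveRadial_example.noOptimalInClass RadialCoulomb.ratio_quantile⟩
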